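/- Let $m\ge 2$, $n\ge 1$, $0<\varepsilon\le 1$, $0<\delta<1$. Let $\mathcal F=\{f_1,\dots,f_m\}$ be a family of $m$ piecewise linear probability densities on $\mathbb R$ with $n$ pieces each, given as follows: a sorted list $a_1\le\dots\le a_s$ of real numbers, $s\le 2mn$, which contains all endpoints of pieces, and for each $j$ indices $1\le b_{j1}<c_{j1}\le b_{j2}<c_{j2}\le\dots\le b_{jn}<c_{jn}\le s$ and coefficients $\alpha_{j\ell},\beta_{j\ell}\in\mathbb R$ such that $f_j(x)=\alpha_{j\ell}+\beta_{j\ell}x$ for $x\in[a_{b_{j\ell}},a_{c_{j\ell}})$, $1\le\ell\le n$, and $f_j(x)=0$ for all other $x$. There are an absolute constant $K$ and a single randomized algorithm which, on every such input $(\mathcal F,\varepsilon,\delta)$, computes numbers $D_{jk}$, $1\le j,k\le m$, such that with probability at least $1-\delta$, $$(1-\varepsilon)D_{jk}\le\|f_j-f_k\|_1\le(1+\varepsilon)D_{jk}\qquad\text{for all } j,k\in\{1,\dots,m\},$$ and which always halts after at most $K\,m(m+n)\,\varepsilon^{-2}\ln(m/\delta)$ operations. Here the algorithm is a program for a real random-access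 machine, with memory cells for natural and for real numbers; the operations, each of unit cost, are: addition, subtraction and multiplication of natural numbers and of real numbers, division of real numbers, conversion of a natural number to a real number, the functions $\sqrt{\cdot}$, $\exp$, $\ln$, $\sin$, $\cos$, $\arctan$ on real numbers, comparisons, tests, indexed access to the memory, and drawing an independent random number with the uniform distribution on $[0,1]$. -/

import Mathlib

/-! ## A randomized real random-access machine

Programs are structured programs over a memory that consists of arrays of natural numbers and
arrays of real numbers, with computed indices (indirect addressing).  There is no operation that
rounds a real number to an integer, and the only random primitive draws a number that is uniformly
distributed on `[0, 1]`.  Every operation (arithmetic operation, elementary function, comparison,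
memory access, test of a loop, random draw) has unit cost. -/

namespace RealRAM

/-- The memory: `nat A i` and `real A i` are the `i`-th cells of the `A`-th array of natural and of
real numbers; `used` is the number of random numbers drawn so far. -/
structure State where
  nat : ℕ → ℕ → ℕ
  real : ℕ → ℕ → ℝ
  used : ℕ

/-- Expressions with values in the natural numbers (`sub` is truncated subtraction). -/
inductive NExpr where
  | const (n : ℕ)
  | get (A : ℕ) (i : NExpr)
  | add (e₁ e₂ : NExpr)
  | sub (e₁ e₂ : NExpr)
  | mul (e₁ e₂ : NExpr)

def NExpr.eval (σ : State) : NExpr → ℕ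
  | .const n => n
  | .get A i => σ.nat A (i.eval σ)
  | .add e₁ e₂ => e₁.eval σ + e₂.eval σ
  | .sub e₁ e₂ => e₁.eval σ - e₂.eval σ
  | .mul e₁ e₂ => e₁.eval σ * e₂.eval σ

def NExpr.cost : NExpr → ℕ
  | .const _ => 1
  | .get _ i => i.cost + 1
  | .add e₁ e₂ => e₁.cost + e₂.cost + 1
  | .sub e₁ e₂ => e₁.cost + e₂.cost + 1
  | .mul e₁ e₂ => e₁.cost + e₂.cost + 1

/-- Expressions with real values: field operations and elementary functions.  Outside the usual
domain of an operation (division by zero, square root of a negative number, logarithm of a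
nonpositive number) the value is a conventional one, which a program can avoid by a test. -/
inductive RExpr where
  | cast (e : NExpr)
  | get (A : ℕ) (i : NExpr)
  | add (e₁ e₂ : RExpr)
  | sub (e₁ e₂ : RExpr)
  | mul (e₁ e₂ : RExpr)
  | div (e₁ e₂ : RExpr)
  | sqrt (e : RExpr)
  | exp (e : RExpr)
  | log (e : RExpr)
  | sin (e : RExpr)
  | cos (e : RExpr)
  | arctan (e : RExpr)

noncomputable def RExpr.eval (σ : State) : RExpr → ℝ
  | .cast e => (e.eval σ : ℝ)
  | .get A i => σ.real A (i.eval σ)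
  | .add e₁ e₂ => e₁.eval σ + e₂.eval σ
  | .sub e₁ e₂ => e₁.eval σ - e₂.eval σ
  | .mul e₁ e₂ => e₁.eval σ * e₂.eval σ
  | .div e₁ e₂ => e₁.eval σ / e₂.eval σ
  | .sqrt e => Real.sqrt (e.eval σ)
  | .exp e => Real.exp (e.eval σ)
  | .log e => Real.log (e.eval σ)
  | .sin e => Real.sin (e.eval σ)
  | .cos e => Real.cos (e.eval σ)
  | .arctan e => Real.arctan (e.eval σ)

def RExpr.cost : RExpr → ℕ
  | .cast e => e.cost + 1
  | .get _ i => i.cost + 1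
  | .add e₁ e₂ => e₁.cost + e₂.cost + 1
  | .sub e₁ e₂ => e₁.cost + e₂.cost + 1
  | .mul e₁ e₂ => e₁.cost + e₂.cost + 1
  | .div e₁ e₂ => e₁.cost + e₂.cost + 1
  | .sqrt e => e.cost + 1
  | .exp e => e.cost + 1
  | .log e => e.cost + 1
  | .sin e => e.cost + 1
  | .cos e => e.cost + 1
  | .arctan e => e.cost + 1

/-- Tests: comparisons of natural numbers and of real numbers, and Boolean combinations. -/
inductive BExpr where
  | nlt (e₁ e₂ : NExpr)
  | rlt (e₁ e₂ : RExpr)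
  | not (t : BExpr)
  | and (t₁ t₂ : BExpr)

def BExpr.eval (σ : State) : BExpr → Prop
  | .nlt e₁ e₂ => e₁.eval σ < e₂.eval σ
  | .rlt e₁ e₂ => e₁.eval σ < e₂.eval σ
  | .not t => ¬ t.eval σ
  | .and t₁ t₂ => t₁.eval σ ∧ t₂.eval σ

def BExpr.cost : BExpr → ℕ
  | .nlt e₁ e₂ => e₁.cost + e₂.cost + 1
  | .rlt e₁ e₂ => e₁.cost + e₂.cost + 1
  | .not t => t.cost + 1
  | .and t₁ t₂ => t₁.cost + t₂.cost + 1

/-- Programs. `nset A i e` and `rset A i e` are the assignments `A[i] := e` to an array of natural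
and of real numbers, `draw A i` stores a fresh random number in the cell `A[i]` of an array of real
numbers, and `loop t P` repeats `P` as long as the test `t` holds. -/
inductive Prog where
  | skip
  | nset (A : ℕ) (i : NExpr) (e : NExpr)
  | rset (A : ℕ) (i : NExpr) (e : RExpr)
  | draw (A : ℕ) (i : NExpr)
  | seq (P Q : Prog)
  | cond (t : BExpr) (P Q : Prog)
  | loop (t : BExpr) (P : Prog)

def State.setNat (σ : State) (A i v : ℕ) : State :=
  { σ with nat := fun B j => if B = A ∧ j = i then v else σ.nat B j }

noncomputable def State.setReal (σ : State) (A i : ℕ) (v : ℝ) : State :=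
  { σ with real := fun B j => if B = A ∧ j = i then v else σ.real B j }

/-- The possible sequences of random numbers. -/
abbrev Tape : Type := ℕ → unitInterval

/-- `Run ω P σ k τ`: with the random numbers `ω 0, ω 1, …`, the program `P`, started in the
state `σ`, halts after exactly `k` operations, in the state `τ`. -/
inductive Run (ω : Tape) : Prog → State → ℕ → State → Prop where
  | skip (σ : State) : Run ω .skip σ 1 σ
  | nset (A : ℕ) (i e : NExpr) (σ : State) :
      Run ω (.nset A i e) σ (i.cost + e.cost + 1) (σ.setNat A (i.eval σ) (e.eval σ))
  | rset (A : ℕ) (i : NExpr) (e : RExpr) (σ : State) :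
      Run ω (.rset A i e) σ (i.cost + e.cost + 1) (σ.setReal A (i.eval σ) (e.eval σ))
  | draw (A : ℕ) (i : NExpr) (σ : State) :
      Run ω (.draw A i) σ (i.cost + 1)
        { σ.setReal A (i.eval σ) (ω σ.used : ℝ) with used := σ.used + 1 }
  | seq {P Q : Prog} {σ τ υ : State} {k l : ℕ} :
      Run ω P σ k τ → Run ω Q τ l υ → Run ω (.seq P Q) σ (k + l) υ
  | cond_true {t : BExpr} {P Q : Prog} {σ τ : State} {k : ℕ} :
      t.eval σ → Run ω P σ k τ → Run ω (.cond t P Q) σ (t.cost + k + 1) τ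
  | cond_false {t : BExpr} {P Q : Prog} {σ τ : State} {k : ℕ} :
      ¬ t.eval σ → Run ω Q σ k τ → Run ω (.cond t P Q) σ (t.cost + k + 1) τ
  | loop_false {t : BExpr} {P : Prog} {σ : State} :
      ¬ t.eval σ → Run ω (.loop t P) σ (t.cost + 1) σ
  | loop_true {t : BExpr} {P : Prog} {σ τ υ : State} {k l : ℕ} :
      t.eval σ → Run ω P σ k τ → Run ω (.loop t P) τ l υ →
      Run ω (.loop t P) σ (t.cost + 1 + k + l) υ

/-- A run is determined by the program, the initial state and the random numbers. -/
theorem Run.deterministic {ω : Tape} {P : Prog} {σ τ τ' : State} {k k' : ℕ}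
    (h : Run ω P σ k τ) (h' : Run ω P σ k' τ') : k = k' ∧ τ = τ' := by
  induction h generalizing k' τ' with
  | skip | nset | rset | draw => cases h'; exact ⟨rfl, rfl⟩
  | seq _ _ ih₁ ih₂ =>
    cases h' with
    | seq a b =>
      obtain ⟨rfl, rfl⟩ := ih₁ a
      obtain ⟨rfl, rfl⟩ := ih₂ b
      exact ⟨rfl, rfl⟩
  | cond_true ht _ ih =>
    cases h' with
    | cond_true _ a => obtain ⟨rfl, rfl⟩ := ih a; exact ⟨rfl, rfl⟩
    | cond_false hn _ => exact absurd ht hn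
  | cond_false hn _ ih =>
    cases h' with
    | cond_true ht _ => exact absurd ht hn
    | cond_false _ a => obtain ⟨rfl, rfl⟩ := ih a; exact ⟨rfl, rfl⟩
  | loop_false hn =>
    cases h' with
    | loop_false _ => exact ⟨rfl, rfl⟩
    | loop_true ht _ _ => exact absurd ht hn
  | loop_true ht _ _ ih₁ ih₂ =>
    cases h' with
    | loop_false hn => exact absurd ht hn
    | loop_true _ a b =>
      obtain ⟨rfl, rfl⟩ := ih₁ a
      obtain ⟨rfl, rfl⟩ := ih₂ b
      exact ⟨rfl, rfl⟩

/-- The law of a sequence of independent random numbers, uniformly distributed on `[0, 1]`. -/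
noncomputable def tapeLaw : MeasureTheory.Measure Tape :=
  MeasureTheory.Measure.infinitePi
    (fun _ : ℕ => (MeasureTheory.volume : MeasureTheory.Measure unitInterval))

instance : MeasureTheory.IsProbabilityMeasure tapeLaw := by
  unfold tapeLaw; infer_instance

end RealRAM

/-! ## Families of piecewise linear densities -/

/-- A family of `m` piecewise linear probability densities on the real line with `n` pieces each.
All endpoints of pieces are among `a 0 ≤ … ≤ a (s - 1)`, where `s ≤ 2 m n`.  The `l`-th piece of
the `j`-th density is the interval `[a (b j l), a (c j l))`, and there the density is
`x ↦ α₀ j l + α₁ j l * x`; outside its pieces it vanishes. -/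
structure PiecewiseLinearDensities (m n s : ℕ) where
  a : Fin s → ℝ
  b : Fin m → Fin n → Fin s
  c : Fin m → Fin n → Fin s
  α₀ : Fin m → Fin n → ℝ
  α₁ : Fin m → Fin n → ℝ
  s_le : s ≤ 2 * m * n
  a_mono : Monotone a
  b_lt_c : ∀ j l, b j l < c j l
  c_le_b : ∀ j l l', l < l' → c j l ≤ b j l'
  nonneg : ∀ (j : Fin m) (x : ℝ),
    0 ≤ ∑ l, (Set.Ico (a (b j l)) (a (c j l))).indicator (fun y => α₀ j l + α₁ j l * y) x
  integral_eq_one : ∀ j : Fin m,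
    ∫ x : ℝ, ∑ l, (Set.Ico (a (b j l)) (a (c j l))).indicator
      (fun y => α₀ j l + α₁ j l * y) x = 1

namespace PiecewiseLinearDensities

variable {m n s : ℕ}

/-- The `j`-th density of the family. -/
noncomputable def density (F : PiecewiseLinearDensities m n s) (j : Fin m) (x : ℝ) : ℝ :=
  ∑ l, (Set.Ico (F.a (F.b j l)) (F.a (F.c j l))).indicator
    (fun y => F.α₀ j l + F.α₁ j l * y) x

/-- The `L₁`-distance of the `j`-th and the `k`-th density. -/
noncomputable def dist (F : PiecewiseLinearDensities m n s) (j k : Fin m) : ℝ :=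
  ∫ x : ℝ, |F.density j x - F.density k x|

/-- The table `u` in row-major order (the entry `u j l` has index `j * n + l`), followed by
zeros. -/
def flatten {R : Type*} [Zero R] (u : Fin m → Fin n → R) (i : ℕ) : R :=
  if h : i < m * n then
    u (finProdFinEquiv.symm ⟨i, h⟩).1 (finProdFinEquiv.symm ⟨i, h⟩).2
  else 0

/-- The initial state of the machine on the input `F`, `ε`, `δ`.
Arrays of natural numbers: `0` holds `m, n, s`; `1` and `2` hold the indices `b j l` and `c j l`.
Arrays of real numbers: `0` holds `ε, δ`; `1` holds the endpoints `a i`; `2` and `3` hold the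
coefficients `α₀ j l` and `α₁ j l`.  All other cells are zero. -/
noncomputable def input (F : PiecewiseLinearDensities m n s) (ε δ : ℝ) : RealRAM.State where
  nat A i :=
    match A with
    | 0 => if i = 0 then m else if i = 1 then n else if i = 2 then s else 0
    | 1 => flatten (fun j l => (F.b j l : ℕ)) i
    | 2 => flatten (fun j l => (F.c j l : ℕ)) i
    | _ => 0
  real A i :=
    match A with
    | 0 => if i = 0 then ε else if i = 1 then δ else 0
    | 1 => if h : i < s then F.a ⟨i, h⟩ else 0
    | 2 => flatten F.α₀ i
    | 3 => flatten F.α₁ i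
    | _ => 0
  used := 0

end PiecewiseLinearDensities

/-- The number `D j k` that a final state holds as output: the entry with index `j * m + k` of the
array number `4` of real numbers. -/
def RealRAM.State.output (σ : RealRAM.State) (m : ℕ) (j k : Fin m) : ℝ :=
  σ.real 4 ((j : ℕ) * m + (k : ℕ))

/-- `D` approximates all pairwise `L₁`-distances of the family with relative error `ε`. -/
def PiecewiseLinearDensities.RelativeErrorApprox {m n s : ℕ}
    (F : PiecewiseLinearDensities m n s) (ε : ℝ) (D : Fin m → Fin m → ℝ) : Prop :=
  ∀ j k, (1 - ε) * D j k ≤ F.dist j k ∧ F.dist j k ≤ (1 + ε) * D j k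

/-! ### The standard Cauchy law: quantile transform, scaling and stability. -/

open MeasureTheory ProbabilityTheory
open scoped ENNReal NNReal

/-! The method is Cauchy (1-stable) sketching of a randomized quadrature. The sorted endpoints cut
the line into at most `2mn` cells on which every density is affine. A uniform shift per cell selects
one node in each half of the cell. The resulting two-point rule for the `L₁`-norm `d` of a
difference is unbiased, and it always lies between `d/6` and `4d`, because two values half a cell
apart control an affine function (`le_cellScale`, `cellScale_le`, `integral_cellScale`).

Multiplying the weighted node values by independent Cauchy variables and summing gives a sketch that
is linear in the function. By stability it is, given the nodes, a Cauchy variable whose scale is the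
quadrature value (`map_sum_cauchyQuantile`). Linearity lets `m` sketches serve all pairs, and prefix
sums of the random weights and of weights times nodes give the contribution of each piece in
constant time. One repetition thus costs `O(mn)` for the sketches and `O(m²)` for the pairs.

A Cauchy variable has no mean, but the geometric mean of the absolute values of four sketches with
the same nodes has the mean `geomMeanConst * d`, a second moment of order `d²` and an inverse moment
of order `1/d` (`lintegral_blockMean_rpow`).

Such moments alone do not make a plain average concentrate exponentially, so the values are
truncated at a level of order `d/ε`. The unknown `d` is replaced there by the geometric mean over
all repetitions, which is correct up to the factor 24. The level depends on the data, but the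
truncated sum is monotone in the level, so Chernoff bounds at two deterministic levels suffice
(`truncatedMean_isApprox`, `pi_truncatedMean_blockMean_le`). The failure probability is
exponentially small in `N ε²`; with `N` of order `ε⁻² log (m/δ)`, a union bound over the pairs
finishes. If `d = 0`, the estimate is exactly zero.

On the machine side, Hoare-style rules with cost bounds (`Halts`, `Frame`) show that the program
outputs precisely this estimator (`distanceProg_halts`, `sketchMean_eq_blockMean`). -/

/-- The quantile transform of the standard Cauchy distribution. -/
noncomputable def cauchyQuantile (u : unitInterval) : ℝ := Real.tan (Real.pi * ((u : ℝ) - 1 / 2))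

theorem measurable_real_tan : Measurable Real.tan := by
  have : Real.tan = fun x => Real.sin x / Real.cos x := by
    ext x; exact Real.tan_eq_sin_div_cos x
  rw [this]
  exact Real.measurable_sin.div Real.measurable_cos

theorem measurable_cauchyQuantile : Measurable cauchyQuantile := by
  unfold cauchyQuantile
  exact measurable_real_tan.comp (by fun_prop)

theorem lintegral_unitInterval (f : ℝ → ℝ≥0∞) :
    ∫⁻ u : unitInterval, f u = ∫⁻ x in Set.Icc (0 : ℝ) 1, f x := by
  rw [← lintegral_subtype_comap (μ := volume) measurableSet_Icc]
  rfl

theorem lintegral_cauchyMeasure (γ : ℝ≥0) (hγ : γ ≠ 0) {f : ℝ → ℝ≥0∞} (hf : Measurable f) :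
    ∫⁻ x, f x ∂(cauchyMeasure 0 γ) = ∫⁻ x, cauchyPDF 0 γ x * f x := by
  rw [cauchyMeasure_of_scale_ne_zero _ hγ,
    lintegral_withDensity_eq_lintegral_mul _ (measurable_cauchyPDF 0 γ) hf]
  rfl

theorem range_arctan_div_pi :
    (fun x : ℝ => Real.arctan x / Real.pi + 1 / 2) '' Set.univ = Set.Ioo 0 1 := by
  have hpi := Real.pi_pos
  ext u
  simp only [Set.image_univ, Set.mem_range, Set.mem_Ioo]
  constructor
  · rintro ⟨x, rfl⟩
    have h1 := Real.neg_pi_div_two_lt_arctan x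
    have h2 := Real.arctan_lt_pi_div_two x
    constructor
    · have : -(1 / 2) < Real.arctan x / Real.pi := by rw [lt_div_iff₀ hpi]; linarith
      linarith
    · have : Real.arctan x / Real.pi < 1 / 2 := by rw [div_lt_iff₀ hpi]; linarith
      linarith
  · rintro ⟨h1, h2⟩
    refine ⟨Real.tan (Real.pi * (u - 1 / 2)), ?_⟩
    rw [Real.arctan_tan (by nlinarith) (by nlinarith)]
    field_simp
    ring

/-- Change of variables along the inverse map `x ↦ arctan x / π + 1/2`, whose derivative is the
Cauchy density. The endpoints 0 and 1 form a null set, so the values there do not matter. -/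
theorem map_cauchyQuantile :
    (volume : Measure unitInterval).map cauchyQuantile = cauchyMeasure 0 1 := by
  have hpi := Real.pi_pos
  refine Measure.ext_of_lintegral _ fun f hf => ?_
  rw [lintegral_map hf measurable_cauchyQuantile, lintegral_cauchyMeasure 1 one_ne_zero hf]
  have := lintegral_unitInterval (fun x : ℝ => f (Real.tan (Real.pi * (x - 1 / 2))))
  unfold cauchyQuantile
  rw [this, ← setLIntegral_congr (Ioo_ae_eq_Icc (a := (0 : ℝ)) (b := 1)), ← range_arctan_div_pi,
    lintegral_image_eq_lintegral_abs_deriv_mul MeasurableSet.univ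
      (f' := fun x => (1 / (1 + x ^ 2)) / Real.pi)]
  · rw [setLIntegral_univ]
    refine lintegral_congr fun x => ?_
    have h1 : Real.pi * (Real.arctan x / Real.pi + 1 / 2 - 1 / 2) = Real.arctan x := by
      field_simp; ring
    rw [h1, Real.tan_arctan, cauchyPDF_def, cauchyPDFReal_def, abs_of_pos (by positivity)]
    congr 2
    simp
    field_simp
    ring
  · intro x _
    exact (((Real.hasDerivAt_arctan x).div_const _).add_const _).hasDerivWithinAt
  · intro x _ y _ h
    simp only [add_left_inj] at h
    exact Real.arctan_injective ((div_left_inj' hpi.ne').mp h)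

theorem map_mul_cauchyMeasure (γ : ℝ≥0) :
    (cauchyMeasure 0 1).map (fun x => (γ : ℝ) * x) = cauchyMeasure 0 γ := by
  rcases eq_or_ne γ 0 with rfl | hγ
  · simp
  have hg : (0 : ℝ) < γ := by positivity
  refine Measure.ext_of_lintegral _ fun f hf => ?_
  rw [lintegral_map hf (by fun_prop), lintegral_cauchyMeasure 1 one_ne_zero (by fun_prop),
    lintegral_cauchyMeasure γ hγ hf]
  have himg : (fun x : ℝ => (γ : ℝ) * x) '' Set.univ = Set.univ := by
    rw [Set.image_univ]
    exact (mul_left_surjective₀ hg.ne').range_eq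
  conv_rhs => rw [← setLIntegral_univ, ← himg]
  rw [lintegral_image_eq_lintegral_abs_deriv_mul MeasurableSet.univ (f' := fun _ => (γ : ℝ)),
    setLIntegral_univ]
  · refine lintegral_congr fun x => ?_
    rw [← mul_assoc]
    congr 1
    rw [cauchyPDF_def, cauchyPDF_def, cauchyPDFReal_def, cauchyPDFReal_def,
      ← ENNReal.ofReal_mul (abs_nonneg _), abs_of_pos hg]
    congr 1
    simp
    field_simp
  · intro x _
    simpa using (((hasDerivAt_id x).const_mul (γ : ℝ)).hasDerivWithinAt (s := Set.univ))
  · intro x _ y _ h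
    exact mul_left_cancel₀ hg.ne' h

-- Splitting at 0 leaves two elementary exponential integrals. The result is integrable in `ξ`, so
-- Fourier inversion will give the characteristic function of the Cauchy law without contour
-- integration.
open scoped FourierTransform in
theorem fourier_exp_neg_abs (ξ : ℝ) :
    𝓕 (fun x : ℝ => ((Real.exp (-|x|) : ℝ) : ℂ)) ξ = ((2 / (1 + (2 * Real.pi * ξ) ^ 2) : ℝ) : ℂ) := by
  rw [Real.fourier_real_eq_integral_exp_smul]
  set t : ℝ := 2 * Real.pi * ξ with ht
  have hr1 : ((-1 : ℂ) - t * Complex.I).re < 0 := by simp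
  have hr2 : 0 < ((1 : ℂ) - t * Complex.I).re := by simp
  have e1 : Set.EqOn (fun v : ℝ => Complex.exp (((-2 * Real.pi * v * ξ : ℝ) : ℂ) * Complex.I) •
      ((Real.exp (-|v|) : ℝ) : ℂ)) (fun v : ℝ => Complex.exp (((-1 : ℂ) - t * Complex.I) * v))
      (Set.Ioi 0) := by
    intro v hv
    simp only [smul_eq_mul, abs_of_pos hv.out, Complex.ofReal_exp, ← Complex.exp_add]
    congr 1
    rw [ht]; push_cast; ring
  have e2 : Set.EqOn (fun v : ℝ => Complex.exp (((-2 * Real.pi * v * ξ : ℝ) : ℂ) * Complex.I) •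
      ((Real.exp (-|v|) : ℝ) : ℂ)) (fun v : ℝ => Complex.exp (((1 : ℂ) - t * Complex.I) * v))
      (Set.Iic 0) := by
    intro v hv
    simp only [smul_eq_mul, abs_of_nonpos hv.out, Complex.ofReal_exp, ← Complex.exp_add]
    congr 1
    rw [ht]; push_cast; ring
  have i1 := integrableOn_exp_mul_complex_Ioi hr1 0
  have i2 := integrableOn_exp_mul_complex_Iic hr2 0
  rw [← intervalIntegral.integral_Iic_add_Ioi
      ((integrableOn_congr_fun e2 measurableSet_Iic).mpr i2)
      ((integrableOn_congr_fun e1 measurableSet_Ioi).mpr i1),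
    setIntegral_congr_fun measurableSet_Ioi e1, setIntegral_congr_fun measurableSet_Iic e2,
    integral_exp_mul_complex_Ioi hr1, integral_exp_mul_complex_Iic hr2]
  have n1 : ((-1 : ℂ) - t * Complex.I) ≠ 0 := fun h => by rw [h] at hr1; simp at hr1
  have n2 : ((1 : ℂ) - t * Complex.I) ≠ 0 := fun h => by rw [h] at hr2; simp at hr2
  have n3 : (1 + (t : ℂ) ^ 2) ≠ 0 := by
    have : (0 : ℝ) < 1 + t ^ 2 := by positivity
    exact_mod_cast this.ne'
  push_cast
  simp only [mul_zero, Complex.exp_zero]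
  field_simp
  ring_nf
  simp [Complex.I_sq]
  ring

theorem integrable_exp_neg_abs : Integrable (fun x : ℝ => Real.exp (-|x|)) := by
  rw [← integrableOn_univ, ← Set.Iic_union_Ioi (a := (0 : ℝ)), integrableOn_union]
  constructor
  · refine (integrableOn_congr_fun ?_ measurableSet_Iic).mpr (integrableOn_exp_mul_Iic one_pos 0)
    intro x hx
    simp [abs_of_nonpos hx.out]
  · refine (integrableOn_congr_fun ?_ measurableSet_Ioi).mpr
      (integrableOn_exp_mul_Ioi (a := -1) (by norm_num) 0)
    intro x hx
    simp [abs_of_pos hx.out]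

-- Fourier inversion for `exp (-|x|)`, after rescaling the frequency by `2π`.
open scoped FourierTransform in
theorem integral_exp_mul_cauchy (t : ℝ) :
    ∫ x : ℝ, Complex.exp ((t * x : ℝ) * Complex.I) * ((Real.pi⁻¹ * (1 + x ^ 2)⁻¹ : ℝ) : ℂ) =
      ((Real.exp (-|t|) : ℝ) : ℂ) := by
  have hpi := Real.pi_pos
  have hF : 𝓕 (fun x : ℝ => ((Real.exp (-|x|) : ℝ) : ℂ)) =
      fun ξ => ((2 / (1 + (2 * Real.pi * ξ) ^ 2) : ℝ) : ℂ) := funext fourier_exp_neg_abs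
  have hint : Integrable (fun ξ : ℝ => ((2 / (1 + (2 * Real.pi * ξ) ^ 2) : ℝ) : ℂ)) := by
    have := ((integrable_inv_one_add_sq.comp_mul_left' (R := 2 * Real.pi) (by positivity)).const_mul
      2).ofReal (𝕜 := ℂ)
    simpa [div_eq_mul_inv] using this
  have key := congrFun (Continuous.fourierInv_fourier_eq
    (f := fun x : ℝ => ((Real.exp (-|x|) : ℝ) : ℂ)) (by fun_prop)
    integrable_exp_neg_abs.ofReal (by rw [hF]; exact hint)) t
  rw [hF, Real.fourierInv_eq'] at key
  rw [← key]
  have hs := Measure.integral_comp_mul_left (fun x : ℝ => Complex.exp ((t * x : ℝ) * Complex.I) *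
    ((Real.pi⁻¹ * (1 + x ^ 2)⁻¹ : ℝ) : ℂ)) (2 * Real.pi)
  have h2 : (∫ x : ℝ, Complex.exp ((t * x : ℝ) * Complex.I) *
      ((Real.pi⁻¹ * (1 + x ^ 2)⁻¹ : ℝ) : ℂ)) = (2 * Real.pi) •
      ∫ x : ℝ, Complex.exp ((t * (2 * Real.pi * x) : ℝ) * Complex.I) *
        ((Real.pi⁻¹ * (1 + (2 * Real.pi * x) ^ 2)⁻¹ : ℝ) : ℂ) := by

    rw [hs, abs_of_pos (by positivity), smul_smul, mul_inv_cancel₀ (by positivity), one_smul]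
  rw [h2, ← integral_smul]
  refine integral_congr_ae (ae_of_all _ fun x => ?_)
  simp only [Complex.real_smul, smul_eq_mul]
  have : (2 / (1 + (2 * Real.pi * x) ^ 2) : ℝ) =
      2 * Real.pi * (Real.pi⁻¹ * (1 + (2 * Real.pi * x) ^ 2)⁻¹) := by field_simp
  rw [this]
  have h3 : (t * (2 * Real.pi * x) : ℝ) = 2 * Real.pi * inner ℝ x t := by simp; ring
  rw [h3, Complex.ofReal_mul (2 * Real.pi) (Real.pi⁻¹ * _)]
  ring

theorem charFun_cauchyMeasure_one (t : ℝ) :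
    charFun (cauchyMeasure 0 1) t = ((Real.exp (-|t|) : ℝ) : ℂ) := by
  rw [charFun_apply_real, cauchyMeasure_of_scale_ne_zero _ one_ne_zero,
    integral_withDensity_eq_integral_toReal_smul (measurable_cauchyPDF 0 1)
      (ae_of_all _ fun x => by simp [cauchyPDF]), ← integral_exp_mul_cauchy]
  refine integral_congr_ae (ae_of_all _ fun x => ?_)
  simp only [cauchyPDF, Complex.real_smul]
  rw [ENNReal.toReal_ofReal (cauchyPDF_pos 0 one_ne_zero x).le, cauchyPDFReal_def, mul_comm]
  simp [add_comm]

theorem charFun_cauchyMeasure (γ : ℝ≥0) (t : ℝ) :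
    charFun (cauchyMeasure 0 γ) t = ((Real.exp (-(γ * |t|)) : ℝ) : ℂ) := by
  rw [← map_mul_cauchyMeasure, charFun_map_mul, charFun_cauchyMeasure_one, abs_mul,
    NNReal.abs_eq]

/-- Linear combinations of independent standard Cauchy variables are Cauchy variables. -/
theorem map_sum_cauchyQuantile {ι : Type*} [Fintype ι] (c : ι → ℝ) :
    (Measure.pi fun _ : ι => (volume : Measure unitInterval)).map
      (fun u => ∑ p, c p * cauchyQuantile (u p)) = cauchyMeasure 0 (∑ p, ‖c p‖₊) := by
  have hm : ∀ p, Measurable fun u : ι → unitInterval => c p * cauchyQuantile (u p) := fun p =>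
    (measurable_cauchyQuantile.comp (measurable_pi_apply p)).const_mul _
  have hmq := measurable_cauchyQuantile
  have : IsProbabilityMeasure ((Measure.pi fun _ : ι => (volume : Measure unitInterval)).map
      (fun u => ∑ p, c p * cauchyQuantile (u p))) :=
    Measure.isProbabilityMeasure_map (Finset.measurable_sum _ fun p _ => hm p).aemeasurable
  refine Measure.ext_of_charFun ?_
  have hind : iIndepFun (fun p (u : ι → unitInterval) => c p * cauchyQuantile (u p))
      (Measure.pi fun _ : ι => (volume : Measure unitInterval)) :=
    iIndepFun_pi (X := fun p u => c p * cauchyQuantile u)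
      (fun p => (measurable_cauchyQuantile.const_mul _).aemeasurable)
  rw [hind.charFun_map_fun_sum_eq_prod fun p => (hm p).aemeasurable]
  ext t
  rw [Finset.prod_apply, charFun_cauchyMeasure]
  have : ∀ p, charFun ((Measure.pi fun _ : ι => (volume : Measure unitInterval)).map
      (fun u => c p * cauchyQuantile (u p))) t = ((Real.exp (-(|c p| * |t|)) : ℝ) : ℂ) := by
    intro p
    have h1 : (Measure.pi fun _ : ι => (volume : Measure unitInterval)).map
      (fun u => c p * cauchyQuantile (u p)) = (cauchyMeasure 0 1).map (fun x => c p * x) := by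
      have hp := measurePreserving_eval (fun _ : ι => (volume : Measure unitInterval)) p
      have h2 := Measure.map_map (μ := Measure.pi fun _ : ι => (volume : Measure unitInterval))
        (hmq.const_mul (c p)) hp.measurable
      rw [hp.map_eq] at h2
      rw [← map_cauchyQuantile, Measure.map_map (by fun_prop) hmq]
      exact h2.symm
    rw [h1, charFun_map_mul, charFun_cauchyMeasure_one, abs_mul]
  simp_rw [this]
  -- The exponents are linear in the scales; hence the product of the characteristic functions is
  -- again Cauchy, and the scales add.
  rw [← Complex.ofReal_prod, ← Real.exp_sum]
  congr 2
  rw [Finset.sum_neg_distrib]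
  push_cast
  rw [Finset.sum_mul]
  rfl

/-! ### Fractional absolute moments of the Cauchy law. -/

theorem lintegral_Ioi_rpow_mul_exp_neg_mul (s r : ℝ) (hs : 0 < s) (hr : 0 < r) :
    ∫⁻ t in Set.Ioi (0 : ℝ), ENNReal.ofReal (t ^ (s - 1) * Real.exp (-(r * t))) =
      ENNReal.ofReal ((1 / r) ^ s * Real.Gamma s) := by
  have hG := Real.Gamma_pos_of_pos hs
  have h := Real.integral_rpow_mul_exp_neg_mul_Ioi hs hr
  have hi : Integrable (fun t : ℝ => t ^ (s - 1) * Real.exp (-(r * t)))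
      (volume.restrict (Set.Ioi 0)) := by
    refine Integrable.of_integral_ne_zero ?_
    rw [h]; positivity
  rw [← h, ofReal_integral_eq_lintegral_ofReal hi]
  filter_upwards [ae_restrict_mem measurableSet_Ioi] with t ht
  have : (0 : ℝ) < t := ht
  positivity

theorem lintegral_Ioi_rpow_mul_exp_neg_mul_sq (q b : ℝ) (hq : -1 < q) (hb : 0 < b) :
    ∫⁻ x in Set.Ioi (0 : ℝ), ENNReal.ofReal (x ^ q * Real.exp (-b * x ^ 2)) =
      ENNReal.ofReal (b ^ (-(q + 1) / 2) * (1 / 2) * Real.Gamma ((q + 1) / 2)) := by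
  have hG := Real.Gamma_pos_of_pos (show 0 < (q + 1) / 2 by linarith)
  have h := integral_rpow_mul_exp_neg_mul_rpow (p := 2) two_pos hq hb
  simp only [Real.rpow_two] at h
  have hi : Integrable (fun x : ℝ => x ^ q * Real.exp (-b * x ^ 2))
      (volume.restrict (Set.Ioi 0)) := by
    refine Integrable.of_integral_ne_zero ?_
    rw [h]; positivity
  rw [← h, ofReal_integral_eq_lintegral_ofReal hi]
  filter_upwards [ae_restrict_mem measurableSet_Ioi] with t ht
  have : (0 : ℝ) < t := ht
  positivity

/-- Write `1 / (1 + x²)` as the integral of `exp (-(1 + x²) t)` over `t > 0` and exchange the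
integrals. The two Gamma integrals combine by the reflection formula. -/
theorem lintegral_Ioi_rpow_div_one_add_sq (a : ℝ) (h1 : -1 < a) (h2 : a < 1) :
    ∫⁻ x in Set.Ioi (0 : ℝ), ENNReal.ofReal (x ^ a * (1 + x ^ 2)⁻¹) =
      ENNReal.ofReal (Real.pi / (2 * Real.cos (Real.pi * a / 2))) := by
  have hs : 0 < (1 - a) / 2 := by linarith
  have e1 : ∀ x ∈ Set.Ioi (0 : ℝ), ENNReal.ofReal (x ^ a * (1 + x ^ 2)⁻¹) =
      ∫⁻ t in Set.Ioi (0 : ℝ), ENNReal.ofReal (x ^ a * Real.exp (-((1 + x ^ 2) * t))) := by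
    intro x hx
    have hx' : (0 : ℝ) < x := hx
    have h := lintegral_Ioi_rpow_mul_exp_neg_mul 1 (1 + x ^ 2) one_pos (by positivity)
    simp only [sub_self, Real.rpow_zero, one_mul, Real.rpow_one, Real.Gamma_one, mul_one,
      one_div] at h
    simp_rw [ENNReal.ofReal_mul (show 0 ≤ x ^ a by positivity)]
    rw [lintegral_const_mul _ (by fun_prop), h]
  have hG := Real.Gamma_pos_of_pos (show 0 < (a + 1) / 2 by linarith)
  have e2 : ∀ t ∈ Set.Ioi (0 : ℝ), (∫⁻ x in Set.Ioi (0 : ℝ),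
      ENNReal.ofReal (x ^ a * Real.exp (-((1 + x ^ 2) * t)))) =
      ENNReal.ofReal ((1 / 2) * Real.Gamma ((a + 1) / 2)) *
        ENNReal.ofReal (t ^ ((1 - a) / 2 - 1) * Real.exp (-(1 * t))) := by
    intro t ht
    have ht' : (0 : ℝ) < t := ht
    have h := lintegral_Ioi_rpow_mul_exp_neg_mul_sq a t h1 ht'
    have h3 : ∀ x : ℝ, ENNReal.ofReal (x ^ a * Real.exp (-((1 + x ^ 2) * t))) =
        ENNReal.ofReal (Real.exp (-t)) * ENNReal.ofReal (x ^ a * Real.exp (-t * x ^ 2)) := by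
      intro x
      rw [← ENNReal.ofReal_mul (Real.exp_nonneg _)]
      congr 1
      rw [show -((1 + x ^ 2) * t) = -t + -t * x ^ 2 by ring, Real.exp_add]
      ring
    simp_rw [h3]
    rw [lintegral_const_mul _ (by fun_prop), h, ← ENNReal.ofReal_mul (Real.exp_nonneg _),
      ← ENNReal.ofReal_mul (by positivity)]
    congr 1
    rw [show -(a + 1) / 2 = (1 - a) / 2 - 1 by ring, one_mul]
    ring
  rw [setLIntegral_congr_fun measurableSet_Ioi e1, lintegral_lintegral_swap
    (Measurable.aemeasurable (by fun_prop)), setLIntegral_congr_fun measurableSet_Ioi e2,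
    lintegral_const_mul _ (by fun_prop), lintegral_Ioi_rpow_mul_exp_neg_mul _ 1 hs one_pos,
    ← ENNReal.ofReal_mul (by positivity)]
  congr 1
  have h := Real.Gamma_mul_Gamma_one_sub ((a + 1) / 2)
  rw [show 1 - (a + 1) / 2 = (1 - a) / 2 by ring,
    show Real.pi * ((a + 1) / 2) = Real.pi * a / 2 + Real.pi / 2 by ring,
    Real.sin_add_pi_div_two] at h
  rw [div_self one_ne_zero, Real.one_rpow, one_mul, mul_assoc, h]
  field_simp

/-- Fractional absolute moments of the standard Cauchy distribution. -/
theorem lintegral_rpow_abs_cauchyMeasure (a : ℝ) (h1 : -1 < a) (h2 : a < 1) :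
    ∫⁻ x, ENNReal.ofReal |x| ^ a ∂(cauchyMeasure 0 1) =
      ENNReal.ofReal (1 / Real.cos (Real.pi * a / 2)) := by
  have hpi := Real.pi_pos
  rw [lintegral_cauchyMeasure 1 one_ne_zero (by fun_prop)]
  have e0 : ∀ x : ℝ, x ∈ Set.Ioi (0 : ℝ) → cauchyPDF 0 1 x * ENNReal.ofReal |x| ^ a =
      ENNReal.ofReal Real.pi⁻¹ * ENNReal.ofReal (x ^ a * (1 + x ^ 2)⁻¹) := by
    intro x hx
    have hx' : (0 : ℝ) < x := hx
    rw [abs_of_pos hx', ENNReal.ofReal_rpow_of_pos hx', cauchyPDF_def, cauchyPDFReal_def,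
      ← ENNReal.ofReal_mul (by positivity), ← ENNReal.ofReal_mul (by positivity)]
    congr 1
    simp [add_comm]
    ring
  have hev : ∀ x : ℝ, cauchyPDF 0 1 (-x) * ENNReal.ofReal |-x| ^ a =
      cauchyPDF 0 1 x * ENNReal.ofReal |x| ^ a := by
    intro x
    simp [cauchyPDF_def, cauchyPDFReal_def]
  have hneg : ∫⁻ x in Set.Iio (0 : ℝ), cauchyPDF 0 1 x * ENNReal.ofReal |x| ^ a =
      ∫⁻ x in Set.Ioi (0 : ℝ), cauchyPDF 0 1 x * ENNReal.ofReal |x| ^ a := by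
    have := (Measure.measurePreserving_neg (volume : Measure ℝ)).setLIntegral_comp_preimage
      (s := Set.Iio (0 : ℝ)) measurableSet_Iio
      (f := fun x => cauchyPDF 0 1 x * ENNReal.ofReal |x| ^ a)
      ((measurable_cauchyPDF 0 1).mul (by fun_prop))
    rw [← this]
    simp only [hev]
    congr 2
    ext x; simp
  rw [← lintegral_add_compl _ (measurableSet_Iio (a := (0 : ℝ))), hneg, Set.compl_Iio,
    setLIntegral_congr (Ioi_ae_eq_Ici (a := (0 : ℝ))).symm,
    setLIntegral_congr_fun measurableSet_Ioi e0, lintegral_const_mul _ (by fun_prop),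
    lintegral_Ioi_rpow_div_one_add_sq a h1 h2, ← ENNReal.ofReal_mul (by positivity)]
  have hc : 0 < Real.cos (Real.pi * a / 2) :=
    Real.cos_pos_of_mem_Ioo ⟨by nlinarith, by nlinarith⟩
  rw [← ENNReal.ofReal_add (by positivity) (by positivity)]
  congr 1
  field_simp
  ring

theorem lintegral_rpow_abs_cauchyMeasure_scale (γ : ℝ≥0) (a : ℝ) (h1 : -1 < a) (h2 : a < 1) :
    ∫⁻ x, ENNReal.ofReal |x| ^ a ∂(cauchyMeasure 0 γ) =
      (γ : ℝ≥0∞) ^ a * ENNReal.ofReal (1 / Real.cos (Real.pi * a / 2)) := by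
  rw [← map_mul_cauchyMeasure, lintegral_map (by fun_prop) (by fun_prop),
    ← lintegral_rpow_abs_cauchyMeasure a h1 h2, ← lintegral_const_mul _ (by fun_prop)]
  refine lintegral_congr fun x => ?_
  rw [abs_mul, ENNReal.ofReal_mul (abs_nonneg _), NNReal.abs_eq, ENNReal.ofReal_coe_nnreal,
    ENNReal.mul_rpow_of_ne_top (by simp) (by simp)]

/-! ### Randomized two-point quadrature of the absolute value of an affine function. -/

theorem abs_endpoint_le_four_mul_integral (P Q : ℝ) :
    |P| ≤ 4 * ∫ u in (0 : ℝ)..1, |P + (Q - P) * u| := by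
  -- The weight `2 - 3u` is orthogonal to `u` and has integral 1/2, so it extracts the endpoint
  -- value. It is bounded by 2 on `[0, 1]`.
  have h : ∫ u in (0 : ℝ)..1, (P + (Q - P) * u) * (2 - 3 * u) = P / 2 := by
    have e : ∀ u : ℝ, HasDerivAt (fun u => 2 * P * u + (2 * (Q - P) - 3 * P) / 2 * u ^ 2
        - (Q - P) * u ^ 3) ((P + (Q - P) * u) * (2 - 3 * u)) u := by
      intro u
      have h1 := (hasDerivAt_id u).const_mul (2 * P)
      have h2 := (hasDerivAt_pow 2 u).const_mul ((2 * (Q - P) - 3 * P) / 2)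
      have h3 := (hasDerivAt_pow 3 u).const_mul (Q - P)
      convert! (h1.add h2).sub h3 using 1
      simp; ring
    rw [intervalIntegral.integral_eq_sub_of_hasDerivAt (fun u _ => e u)
      (Continuous.intervalIntegrable (by fun_prop) _ _)]
    ring
  have h2 : |∫ u in (0 : ℝ)..1, (P + (Q - P) * u) * (2 - 3 * u)| ≤
      ∫ u in (0 : ℝ)..1, 2 * |P + (Q - P) * u| := by
    refine (intervalIntegral.abs_integral_le_integral_abs zero_le_one).trans ?_
    refine intervalIntegral.integral_mono_on zero_le_one
      (Continuous.intervalIntegrable (by fun_prop) _ _)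
      (Continuous.intervalIntegrable (by fun_prop) _ _) fun u hu => ?_
    rw [abs_mul, mul_comm]
    gcongr
    rw [abs_le]; constructor <;> linarith [hu.1, hu.2]
  rw [h, intervalIntegral.integral_const_mul, abs_div, abs_two] at h2
  linarith

theorem abs_endpoint_le_four_mul_integral' (P Q : ℝ) :
    |Q| ≤ 4 * ∫ u in (0 : ℝ)..1, |P + (Q - P) * u| := by
  have h := abs_endpoint_le_four_mul_integral Q P
  have e := intervalIntegral.integral_comp_sub_left (fun u : ℝ => |P + (Q - P) * u|) (1 : ℝ)
    (a := 0) (b := 1)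
  simp only [sub_self, sub_zero] at e
  rw [← e]
  convert h using 5
  ring

theorem abs_affine_le_max (P Q u : ℝ) (h0 : 0 ≤ u) (h1 : u ≤ 1) :
    |P + (Q - P) * u| ≤ max |P| |Q| := by
  have : P + (Q - P) * u = (1 - u) * P + u * Q := by ring
  rw [this]
  calc |(1 - u) * P + u * Q| ≤ |(1 - u) * P| + |u * Q| := abs_add_le _ _
    _ = (1 - u) * |P| + u * |Q| := by
      rw [abs_mul, abs_mul, abs_of_nonneg h0, abs_of_nonneg (by linarith)]
    _ ≤ (1 - u) * max |P| |Q| + u * max |P| |Q| := by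
      gcongr
      exacts [le_max_left _ _, le_max_right _ _]
    _ = max |P| |Q| := by ring

/-- The `z`-th quadrature node in the interval `[a, b]`: a point of the left (`z = 0`) or of the
right (`z = 1`) half of the interval. -/
noncomputable def node (a b θ z : ℝ) : ℝ := a + (b - a) / 2 * (θ + z)

/-- The two-point quadrature of `|p + q x|` on `[a, b]`. -/
noncomputable def cellScale (a b p q θ : ℝ) : ℝ :=
  (b - a) / 2 * |p + q * node a b θ 0| + (b - a) / 2 * |p + q * node a b θ 1|

theorem integral_abs_affine_eq (a b p q : ℝ) :
    ∫ x in a..b, |p + q * x| =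
      (b - a) * ∫ u in (0 : ℝ)..1, |(p + q * a) + ((p + q * b) - (p + q * a)) * u| := by
  have h := intervalIntegral.mul_integral_comp_mul_add (a := 0) (b := 1)
    (f := fun x : ℝ => |p + q * x|) (b - a) a
  simp only [mul_zero, zero_add, mul_one, sub_add_cancel] at h
  rw [← h]
  congr 3
  ext u
  congr 1
  ring

theorem cellScale_le (a b p q θ : ℝ) (hab : a ≤ b) (h0 : 0 ≤ θ) (h1 : θ ≤ 1) :
    cellScale a b p q θ ≤ 4 * ∫ x in a..b, |p + q * x| := by
  have hP := abs_endpoint_le_four_mul_integral (p + q * a) (p + q * b)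
  have hQ := abs_endpoint_le_four_mul_integral' (p + q * a) (p + q * b)
  rw [integral_abs_affine_eq]
  set J := ∫ u in (0 : ℝ)..1, |(p + q * a) + ((p + q * b) - (p + q * a)) * u|
  have hz : ∀ z : ℝ, 0 ≤ z → z ≤ 1 → |p + q * node a b θ z| ≤ 4 * J := by
    intro z hz0 hz1
    have e : p + q * node a b θ z =
        (p + q * a) + ((p + q * b) - (p + q * a)) * ((θ + z) / 2) := by unfold node; ring
    rw [e]
    exact (abs_affine_le_max _ _ _ (by linarith) (by linarith)).trans (max_le hP hQ)
  have i0 := hz 0 le_rfl zero_le_one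
  have i1 := hz 1 zero_le_one le_rfl
  have hw : 0 ≤ (b - a) / 2 := by linarith
  unfold cellScale
  nlinarith [mul_le_mul_of_nonneg_left i0 hw, mul_le_mul_of_nonneg_left i1 hw]

/-- A single node could hit a zero of the function. Two nodes half a cell apart determine the slope
and hence both endpoint values, up to the factor 3; this is why both nodes share one shift `θ`. The
uniform lower bound is what makes the inverse moment finite. -/
theorem le_cellScale (a b p q θ : ℝ) (hab : a ≤ b) (h0 : 0 ≤ θ) (h1 : θ ≤ 1) :
    (∫ x in a..b, |p + q * x|) / 6 ≤ cellScale a b p q θ := by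
  rw [integral_abs_affine_eq]
  set P := p + q * a with hP
  set Q := p + q * b with hQ
  have hJ : ∫ u in (0 : ℝ)..1, |P + (Q - P) * u| ≤ max |P| |Q| := by
    have := intervalIntegral.integral_mono_on (μ := volume) zero_le_one
      (Continuous.intervalIntegrable (u := fun u : ℝ => |P + (Q - P) * u|) (by fun_prop) 0 1)
      (Continuous.intervalIntegrable (u := fun _ : ℝ => max |P| |Q|) (by fun_prop) 0 1)
      fun u hu => abs_affine_le_max P Q u hu.1 hu.2
    simpa using this
  have e0 : p + q * node a b θ 0 = P + (Q - P) * (θ / 2) := by unfold node; rw [hP, hQ]; ring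
  have e1 : p + q * node a b θ 1 = P + (Q - P) * ((θ + 1) / 2) := by
    unfold node; rw [hP, hQ]; ring
  unfold cellScale
  rw [e0, e1]
  set v0 := P + (Q - P) * (θ / 2) with hv0
  set v1 := P + (Q - P) * ((θ + 1) / 2) with hv1
  have d01 : |Q - P| ≤ 2 * (|v0| + |v1|) := by
    have : Q - P = 2 * (v1 - v0) := by rw [hv0, hv1]; ring
    rw [this, abs_mul, abs_two]
    linarith [abs_sub v1 v0]
  have hPs : |P| ≤ 3 * (|v0| + |v1|) := by
    have e : P = v0 - (Q - P) * (θ / 2) := by rw [hv0]; ring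
    have : |P| ≤ |v0| + |Q - P| * (θ / 2) := by
      calc |P| = |v0 - (Q - P) * (θ / 2)| := by rw [← e]
        _ ≤ |v0| + |(Q - P) * (θ / 2)| := abs_sub _ _
        _ = _ := by rw [abs_mul, abs_of_nonneg (show 0 ≤ θ / 2 by linarith)]
    nlinarith [abs_nonneg (Q - P), abs_nonneg v0, abs_nonneg v1]
  have hQs : |Q| ≤ 3 * (|v0| + |v1|) := by
    have e : Q = v0 + (Q - P) * (1 - θ / 2) := by rw [hv0]; ring
    have : |Q| ≤ |v0| + |Q - P| * (1 - θ / 2) := by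
      calc |Q| = |v0 + (Q - P) * (1 - θ / 2)| := by rw [← e]
        _ ≤ |v0| + |(Q - P) * (1 - θ / 2)| := abs_add_le _ _
        _ = _ := by rw [abs_mul, abs_of_nonneg (show 0 ≤ 1 - θ / 2 by linarith)]
    nlinarith [abs_nonneg (Q - P), abs_nonneg v0, abs_nonneg v1]
  have hm := hJ.trans (max_le hPs hQs)
  have hw : 0 ≤ b - a := by linarith
  nlinarith [mul_le_mul_of_nonneg_left hm hw]

theorem cellScale_nonneg (a b p q θ : ℝ) (hab : a ≤ b) : 0 ≤ cellScale a b p q θ := by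
  have : 0 ≤ b - a := by linarith
  unfold cellScale; positivity

/-- As `θ` runs through `[0, 1]`, the two nodes sweep the left and the right half of the interval,
so the rule is unbiased. -/
theorem integral_cellScale (a b p q : ℝ) :
    ∫ θ in (0 : ℝ)..1, cellScale a b p q θ = ∫ x in a..b, |p + q * x| := by
  have hz : ∀ z : ℝ, ∫ θ in (0 : ℝ)..1, (b - a) / 2 * |p + q * node a b θ z| =
      ∫ x in (a + (b - a) / 2 * z)..(a + (b - a) / 2 * (z + 1)), |p + q * x| := by
    intro z
    have h := intervalIntegral.mul_integral_comp_mul_add (a := 0) (b := 1)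
      (f := fun x : ℝ => |p + q * x|) ((b - a) / 2) (a + (b - a) / 2 * z)
    have e1 : (b - a) / 2 * 0 + (a + (b - a) / 2 * z) = a + (b - a) / 2 * z := by ring
    have e2 : (b - a) / 2 * 1 + (a + (b - a) / 2 * z) = a + (b - a) / 2 * (z + 1) := by ring
    rw [e1, e2] at h
    rw [intervalIntegral.integral_const_mul, ← h]
    refine congrArg _ (intervalIntegral.integral_congr fun θ _ => ?_)
    simp only [node]
    ring_nf
  have hc : ∀ z : ℝ, Continuous fun θ : ℝ => (b - a) / 2 * |p + q * node a b θ z| := by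
    intro z; unfold node; fun_prop
  unfold cellScale
  rw [intervalIntegral.integral_add ((hc 0).intervalIntegrable _ _)
    ((hc 1).intervalIntegrable _ _), hz, hz]
  have e1 : a + (b - a) / 2 * (0 : ℝ) = a := by ring
  have e2 : a + (b - a) / 2 * ((0 : ℝ) + 1) = a + (b - a) / 2 * 1 := by ring
  have e3 : a + (b - a) / 2 * ((1 : ℝ) + 1) = b := by ring
  rw [e1, e2, e3]
  exact intervalIntegral.integral_add_adjacent_intervals
    (Continuous.intervalIntegrable (by fun_prop) _ _)
    (Continuous.intervalIntegrable (by fun_prop) _ _)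

theorem continuous_cellScale (a b p q : ℝ) : Continuous (cellScale a b p q) := by
  unfold cellScale node; fun_prop

theorem lintegral_cellScale (a b p q : ℝ) (hab : a ≤ b) :
    ∫⁻ θ : unitInterval, ENNReal.ofReal (cellScale a b p q θ) =
      ENNReal.ofReal (∫ x in a..b, |p + q * x|) := by
  have hc := continuous_cellScale a b p q
  rw [lintegral_unitInterval (fun θ => ENNReal.ofReal (cellScale a b p q θ)),
    ← integral_cellScale, intervalIntegral.integral_of_le zero_le_one,
    ← integral_Icc_eq_integral_Ioc, ofReal_integral_eq_lintegral_ofReal]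
  · exact hc.integrableOn_Icc
  · exact ae_of_all _ fun θ => cellScale_nonneg a b p q θ hab

/-! ### Moments of the geometric mean of four sketches. -/

theorem lintegral_pi_prod {ι : Type*} [Fintype ι] {X : Type*} [MeasurableSpace X] (μ : Measure X)
    [IsProbabilityMeasure μ] {f : X → ℝ≥0∞} (hf : Measurable f) :
    ∫⁻ x : ι → X, ∏ i, f (x i) ∂(Measure.pi fun _ => μ) = (∫⁻ x, f x ∂μ) ^ Fintype.card ι := by
  have hind : iIndepFun (fun (i : ι) (x : ι → X) => f (x i)) (Measure.pi fun _ : ι => μ) :=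
    iIndepFun_pi (X := fun _ x => f x) fun _ => hf.aemeasurable
  rw [lintegral_prod_eq_prod_lintegral_of_indepFun _ _ hind
    fun i => hf.comp (measurable_pi_apply i)]
  have : ∀ i : ι, ∫⁻ x : ι → X, f (x i) ∂(Measure.pi fun _ => μ) = ∫⁻ x, f x ∂μ := fun i =>
    (measurePreserving_eval (fun _ : ι => μ) i).lintegral_comp hf
  simp [this]

/-- A random linear functional with independent standard Cauchy coefficients. -/
noncomputable def cauchySketch {ι : Type*} [Fintype ι] (c : ι → ℝ) (u : ι → unitInterval) : ℝ :=
  ∑ p, c p * cauchyQuantile (u p)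

theorem lintegral_rpow_abs_cauchySketch {ι : Type*} [Fintype ι] (c : ι → ℝ) (a : ℝ)
    (h1 : -1 < a) (h2 : a < 1) :
    ∫⁻ u, ENNReal.ofReal |cauchySketch c u| ^ a ∂(Measure.pi fun _ => volume) =
      ENNReal.ofReal (∑ p, |c p|) ^ a * ENNReal.ofReal (1 / Real.cos (Real.pi * a / 2)) := by
  have hq := measurable_cauchyQuantile
  have hm : Measurable fun u : ι → unitInterval => cauchySketch c u := by
    unfold cauchySketch; fun_prop
  have h := lintegral_rpow_abs_cauchyMeasure_scale (∑ p, ‖c p‖₊) a h1 h2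
  rw [← map_sum_cauchyQuantile] at h
  have h3 := lintegral_map (f := fun x => ENNReal.ofReal |x| ^ a)
    (μ := (Measure.pi fun _ : ι => (volume : Measure unitInterval))) (by fun_prop) hm
  unfold cauchySketch at h3 ⊢
  rw [← h3, h]
  congr 2
  rw [← ENNReal.ofReal_coe_nnreal]
  congr 1
  push_cast
  rfl

/-- Moments of the geometric mean of four independent Cauchy sketches. -/
theorem lintegral_geomMean_cauchySketch {ι : Type*} [Fintype ι] (c : ι → ℝ) (t : ℝ)
    (h1 : -4 < t) (h2 : t < 4) :
    ∫⁻ U : Fin 4 → ι → unitInterval,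
        (∏ q, ENNReal.ofReal |cauchySketch c (U q)| ^ (1 / 4 : ℝ)) ^ t
        ∂(Measure.pi fun _ => Measure.pi fun _ => volume) =
      ENNReal.ofReal (∑ p, |c p|) ^ t *
        ENNReal.ofReal (1 / Real.cos (Real.pi * (t / 4) / 2)) ^ 4 := by
  have hq := measurable_cauchyQuantile
  have hm : Measurable fun u : ι → unitInterval => cauchySketch c u := by
    unfold cauchySketch; fun_prop
  -- Each factor carries only the exponent `t / 4`, which must lie in `(-1, 1)`. This admits `t =
  -- 1`, `2` and `-1`, the moments that are used.
  have e : ∀ U : Fin 4 → ι → unitInterval,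
      (∏ q, ENNReal.ofReal |cauchySketch c (U q)| ^ (1 / 4 : ℝ)) ^ t =
        ∏ q, ENNReal.ofReal |cauchySketch c (U q)| ^ (t / 4) := by
    intro U
    rw [← ENNReal.prod_rpow_of_ne_top]
    · refine Finset.prod_congr rfl fun q _ => ?_
      rw [← ENNReal.rpow_mul]; congr 1; ring
    · intro q _
      exact ENNReal.rpow_ne_top_of_nonneg (by norm_num) ENNReal.ofReal_ne_top
  simp_rw [e]
  rw [lintegral_pi_prod (Measure.pi fun _ : ι => (volume : Measure unitInterval))
    (f := fun u => ENNReal.ofReal |cauchySketch c u| ^ (t / 4)) (by fun_prop),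
    lintegral_rpow_abs_cauchySketch c _ (by linarith) (by linarith), Fintype.card_fin, mul_pow,
    ← ENNReal.rpow_natCast, ← ENNReal.rpow_mul]
  congr 2
  push_cast
  ring

/-- The random numbers used by one sketch: two for every cell. -/
abbrev Row (C : ℕ) : Type := Fin C × Fin 2 → unitInterval

/-- The uniform law on rows. -/
noncomputable abbrev rowLaw (C : ℕ) : Measure (Row C) := Measure.pi fun _ => volume

/-- The random numbers used by one repetition: a row that selects the quadrature nodes, and four
rows of Cauchy variables. -/
abbrev Block (C : ℕ) : Type := Fin 5 → Row C

/-- The uniform law on blocks. -/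
noncomputable abbrev blockLaw (C : ℕ) : Measure (Block C) := Measure.pi fun _ => rowLaw C

section

variable {C : ℕ} (x p q : ℕ → ℝ)

/-- The weight of a quadrature node times the value there of the function that is `p i + q i * y`
on the `i`-th cell `[x i, x (i + 1)]`. -/
noncomputable def cellCoef (u : Row C) (k : Fin C × Fin 2) : ℝ :=
  (x (k.1 + 1) - x k.1) / 2 *
    (p k.1 + q k.1 * node (x k.1) (x (k.1 + 1)) (u (k.1, 0)) ((k.2 : ℕ) : ℝ))

/-- The randomized quadrature of the `L₁`-norm. -/
noncomputable def rowScale (u : Row C) : ℝ := ∑ k, |cellCoef x p q u k|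

/-- The geometric mean of the absolute values of four Cauchy sketches. -/
noncomputable def blockMean (B : Block C) : ℝ :=
  (∏ r : Fin 4, |cauchySketch (cellCoef x p q (B 0)) (B r.succ)|) ^ (1 / 4 : ℝ)

/-- The `L₁`-norm of a function that is affine on every cell. -/
noncomputable def cellNorm (C : ℕ) : ℝ :=
  ∑ i ∈ Finset.range C, ∫ y in x i..x (i + 1), |p i + q i * y|

theorem measurable_cellCoef (k : Fin C × Fin 2) :
    Measurable fun u : Row C => cellCoef x p q u k := by
  unfold cellCoef node; fun_prop

theorem measurable_rowScale : Measurable (rowScale (C := C) x p q) := by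
  have := measurable_cellCoef (C := C) x p q
  unfold rowScale
  exact Finset.measurable_sum _ fun k _ => (this k).abs

theorem measurable_blockMean : Measurable (blockMean (C := C) x p q) := by
  have h := measurable_cellCoef (C := C) x p q
  have hq := measurable_cauchyQuantile
  unfold blockMean cauchySketch
  refine Measurable.pow_const ?_ _
  refine Finset.measurable_prod _ fun r _ => Measurable.abs ?_
  refine Finset.measurable_sum _ fun k _ => ?_
  exact ((h k).comp (measurable_pi_apply 0)).mul (hq.comp (by fun_prop))

theorem blockMean_nonneg (B : Block C) : 0 ≤ blockMean x p q B := by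
  unfold blockMean; positivity

theorem rowScale_eq (hx : ∀ i < C, x i ≤ x (i + 1)) (u : Row C) : rowScale x p q u =
    ∑ i : Fin C, cellScale (x i) (x (i + 1)) (p i) (q i) (u (i, 0)) := by
  unfold rowScale cellScale
  rw [Fintype.sum_prod_type]
  refine Finset.sum_congr rfl fun i _ => ?_
  have hw : 0 ≤ (x (i + 1) - x i) / 2 := by linarith [hx i i.2]
  rw [Fin.sum_univ_two]
  simp only [cellCoef, abs_mul, abs_of_nonneg hw]
  simp

theorem rowScale_le (hx : ∀ i < C, x i ≤ x (i + 1)) (u : Row C) :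
    rowScale x p q u ≤ 4 * cellNorm x p q C := by
  rw [rowScale_eq x p q hx, cellNorm, ← Fin.sum_univ_eq_sum_range
    (fun i => ∫ y in x i..x (i + 1), |p i + q i * y|), Finset.mul_sum]
  exact Finset.sum_le_sum fun i _ => cellScale_le _ _ _ _ _ (hx i i.2) (u _).2.1 (u _).2.2

theorem le_rowScale (hx : ∀ i < C, x i ≤ x (i + 1)) (u : Row C) :
    cellNorm x p q C / 6 ≤ rowScale x p q u := by
  rw [rowScale_eq x p q hx, cellNorm, ← Fin.sum_univ_eq_sum_range
    (fun i => ∫ y in x i..x (i + 1), |p i + q i * y|), Finset.sum_div]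
  exact Finset.sum_le_sum fun i _ => le_cellScale _ _ _ _ _ (hx i i.2) (u _).2.1 (u _).2.2

theorem lintegral_rowScale (hx : ∀ i < C, x i ≤ x (i + 1)) :
    ∫⁻ u, ENNReal.ofReal (rowScale x p q u) ∂(rowLaw C) =
      ENNReal.ofReal (cellNorm x p q C) := by
  have hc := fun i : Fin C => continuous_cellScale (x i) (x (i + 1)) (p i) (q i)
  have e : ∀ u : Row C, ENNReal.ofReal (rowScale x p q u) =
      ∑ i : Fin C, ENNReal.ofReal (cellScale (x i) (x (i + 1)) (p i) (q i) (u (i, 0))) := by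
    intro u
    rw [rowScale_eq x p q hx, ENNReal.ofReal_sum_of_nonneg]
    exact fun i _ => cellScale_nonneg _ _ _ _ _ (hx i i.2)
  have hm : ∀ i : Fin C, Measurable fun θ : unitInterval =>
      ENNReal.ofReal (cellScale (x i) (x (i + 1)) (p i) (q i) θ) := fun i =>
    ((hc i).measurable.comp measurable_subtype_coe).ennreal_ofReal
  have hm' : ∀ i : Fin C, Measurable fun u : Row C =>
      ENNReal.ofReal (cellScale (x i) (x (i + 1)) (p i) (q i) (u (i, 0))) := fun i =>
    (hm i).comp (measurable_pi_apply (i, 0))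
  simp_rw [e]
  rw [lintegral_finsetSum _ fun i _ => hm' i, cellNorm,
    ← Fin.sum_univ_eq_sum_range (fun i => ∫ y in x i..x (i + 1), |p i + q i * y|),
    ENNReal.ofReal_sum_of_nonneg (f := fun i : Fin C => ∫ y in x i..x (i + 1), |p i + q i * y|)
      fun i _ => intervalIntegral.integral_nonneg (hx i i.2) fun _ _ => abs_nonneg _]
  refine Finset.sum_congr rfl fun i _ => ?_
  rw [← lintegral_cellScale _ _ _ _ (hx i i.2)]
  exact (measurePreserving_eval (fun _ : Fin C × Fin 2 => (volume : Measure unitInterval))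
    (i, 0)).lintegral_comp (hm i)

/-- Integrate first over the four Cauchy rows with the nodes fixed: the sketches are then
independent Cauchy variables whose common scale is `rowScale`. -/
theorem lintegral_blockMean_rpow (t : ℝ) (h1 : -4 < t) (h2 : t < 4) :
    ∫⁻ B, ENNReal.ofReal (blockMean x p q B) ^ t ∂(blockLaw C) =
      (∫⁻ u, ENNReal.ofReal (rowScale x p q u) ^ t ∂(rowLaw C)) *
        ENNReal.ofReal (1 / Real.cos (Real.pi * (t / 4) / 2)) ^ 4 := by
  have hmp := (measurePreserving_piFinSuccAbove (fun _ : Fin 5 => rowLaw C) 0).symm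
  have hq := measurable_cauchyQuantile
  have hb := measurable_blockMean (C := C) x p q
  have hr := measurable_rowScale (C := C) x p q
  rw [← hmp.lintegral_comp (by fun_prop), lintegral_prod _ (by fun_prop),
    ← lintegral_mul_const _ (by fun_prop)]
  refine lintegral_congr fun u => ?_
  rw [rowScale, ← lintegral_geomMean_cauchySketch _ t h1 h2]
  refine lintegral_congr fun U => ?_
  congr 1
  rw [blockMean, ← Real.finsetProd_rpow _ _ fun _ _ => abs_nonneg _, ENNReal.ofReal_prod_of_nonneg
    fun _ _ => by positivity]
  refine Finset.prod_congr rfl fun r _ => ?_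
  rw [ENNReal.ofReal_rpow_of_nonneg (abs_nonneg _) (by norm_num)]
  rfl

/-- The expected value of the geometric mean of four standard Cauchy variables. -/
noncomputable def geomMeanConst : ℝ := 8 / (3 + 2 * Real.sqrt 2)

/-- The closed form contains only a square root, so the program can divide by this constant exactly.
-/
theorem geomMeanConst_eq : (1 / Real.cos (Real.pi / 8)) ^ 4 = geomMeanConst := by
  have h2 : Real.sqrt 2 ^ 2 = 2 := Real.sq_sqrt (by norm_num)
  have h3 : Real.sqrt (2 + Real.sqrt 2) ^ 2 = 2 + Real.sqrt 2 := Real.sq_sqrt (by positivity)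
  have h4 : Real.sqrt (2 + Real.sqrt 2) ^ 4 = 6 + 4 * Real.sqrt 2 := by
    calc Real.sqrt (2 + Real.sqrt 2) ^ 4 = (Real.sqrt (2 + Real.sqrt 2) ^ 2) ^ 2 := by ring
      _ = 4 + 4 * Real.sqrt 2 + Real.sqrt 2 ^ 2 := by rw [h3]; ring
      _ = _ := by rw [h2]; ring
  rw [Real.cos_pi_div_eight, geomMeanConst, one_div, inv_pow, div_pow, h4]
  have : (0 : ℝ) ≤ Real.sqrt 2 := Real.sqrt_nonneg 2
  field_simp
  ring

theorem one_le_geomMeanConst : 1 ≤ geomMeanConst := by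
  have h2 : Real.sqrt 2 ^ 2 = 2 := Real.sq_sqrt (by norm_num)
  have : (0 : ℝ) ≤ Real.sqrt 2 := Real.sqrt_nonneg 2
  rw [geomMeanConst, le_div_iff₀ (by positivity)]
  nlinarith

theorem geomMeanConst_le : geomMeanConst ≤ 7 / 5 := by
  have h2 : Real.sqrt 2 ^ 2 = 2 := Real.sq_sqrt (by norm_num)
  have : (0 : ℝ) ≤ Real.sqrt 2 := Real.sqrt_nonneg 2
  rw [geomMeanConst, div_le_iff₀ (by positivity)]
  nlinarith

variable {x p q}

theorem lintegral_blockMean (hx : ∀ i < C, x i ≤ x (i + 1)) :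
    ∫⁻ B, ENNReal.ofReal (blockMean x p q B) ∂(blockLaw C) =
      ENNReal.ofReal (geomMeanConst * cellNorm x p q C) := by
  have h := lintegral_blockMean_rpow (C := C) x p q 1 (by norm_num) (by norm_num)
  simp only [ENNReal.rpow_one] at h
  rw [h, lintegral_rowScale x p q hx, mul_comm geomMeanConst,
    ENNReal.ofReal_mul' (by linarith [one_le_geomMeanConst]), ← geomMeanConst_eq,
    show Real.pi * (1 / 4) / 2 = Real.pi / 8 by ring, ENNReal.ofReal_pow]
  rw [Real.cos_pi_div_eight]; positivity

/-- The Cauchy factor is `(1 / cos (π/4))⁴ = 4`, and the quadrature is at most `4d`, so `64 = 4 *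
4²`. -/
theorem lintegral_blockMean_sq_le (hx : ∀ i < C, x i ≤ x (i + 1)) :
    ∫⁻ B, ENNReal.ofReal (blockMean x p q B ^ 2) ∂(blockLaw C) ≤
      ENNReal.ofReal (64 * cellNorm x p q C ^ 2) := by
  have h := lintegral_blockMean_rpow (C := C) x p q 2 (by norm_num) (by norm_num)
  have e : ∀ B : Block C, ENNReal.ofReal (blockMean x p q B ^ 2) =
      ENNReal.ofReal (blockMean x p q B) ^ (2 : ℝ) := by
    intro B
    rw [ENNReal.ofReal_pow (blockMean_nonneg x p q B), ENNReal.rpow_two]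
  simp_rw [e]
  rw [h, show Real.pi * (2 / 4) / 2 = Real.pi / 4 by ring, Real.cos_pi_div_four,
    ← ENNReal.ofReal_pow (by positivity)]
  have h4 : (1 / (Real.sqrt 2 / 2)) ^ 4 = 4 := by
    have h2 : Real.sqrt 2 ^ 2 = 2 := Real.sq_sqrt (by norm_num)
    have h4 : Real.sqrt 2 ^ 4 = 4 := by
      calc Real.sqrt 2 ^ 4 = (Real.sqrt 2 ^ 2) ^ 2 := by ring
        _ = 4 := by rw [h2]; norm_num
    rw [div_pow, div_pow, h4]; norm_num
  have hb : ∫⁻ u, ENNReal.ofReal (rowScale x p q u) ^ (2 : ℝ) ∂(rowLaw C) ≤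
      ENNReal.ofReal (4 * cellNorm x p q C) ^ (2 : ℝ) := by
    refine (lintegral_mono fun u => ENNReal.rpow_le_rpow
      (ENNReal.ofReal_le_ofReal (rowScale_le x p q hx u)) (by norm_num)).trans ?_
    simp
  rw [h4]
  refine (mul_le_mul_left hb _).trans ?_
  have hd : 0 ≤ cellNorm x p q C := Finset.sum_nonneg fun i hi =>
    intervalIntegral.integral_nonneg (hx i (Finset.mem_range.mp hi)) fun _ _ => abs_nonneg _
  rw [ENNReal.rpow_two, ← ENNReal.ofReal_pow (by positivity), ← ENNReal.ofReal_mul (by positivity)]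
  exact ENNReal.ofReal_le_ofReal (by nlinarith)

/-- The quadrature is at least `d/6`, and the Cauchy factor is `geomMeanConst ≤ 7/5`; `6 * 7/5` is
below `17/2`. -/
theorem lintegral_inv_blockMean_le (hx : ∀ i < C, x i ≤ x (i + 1))
    (hd : 0 < cellNorm x p q C) :
    ∫⁻ B, (ENNReal.ofReal (blockMean x p q B))⁻¹ ∂(blockLaw C) ≤
      ENNReal.ofReal (17 / 2 / cellNorm x p q C) := by
  have h := lintegral_blockMean_rpow (C := C) x p q (-1) (by norm_num) (by norm_num)
  simp only [ENNReal.rpow_neg_one] at h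
  rw [h, show Real.pi * (-1 / 4) / 2 = -(Real.pi / 8) by ring, Real.cos_neg]
  have hc : 0 ≤ 1 / Real.cos (Real.pi / 8) := by rw [Real.cos_pi_div_eight]; positivity
  rw [← ENNReal.ofReal_pow hc, geomMeanConst_eq]
  have hb : ∫⁻ u, (ENNReal.ofReal (rowScale x p q u))⁻¹ ∂(rowLaw C) ≤
      (ENNReal.ofReal (cellNorm x p q C / 6))⁻¹ := by
    refine (lintegral_mono fun u => ENNReal.inv_le_inv.mpr
      (ENNReal.ofReal_le_ofReal (le_rowScale x p q hx u))).trans ?_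
    simp
  refine (mul_le_mul_left hb _).trans ?_
  rw [← ENNReal.ofReal_inv_of_pos (by positivity), ← ENNReal.ofReal_mul (by positivity)]
  apply ENNReal.ofReal_le_ofReal
  have := geomMeanConst_le
  rw [inv_div, div_mul_eq_mul_div]
  gcongr
  linarith

theorem cellNorm_nonneg (hx : ∀ i < C, x i ≤ x (i + 1)) : 0 ≤ cellNorm x p q C :=
  Finset.sum_nonneg fun i hi =>
    intervalIntegral.integral_nonneg (hx i (Finset.mem_range.mp hi)) fun _ _ => abs_nonneg _

theorem integrable_blockMean (hx : ∀ i < C, x i ≤ x (i + 1)) :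
    Integrable (blockMean x p q) (blockLaw C) := by
  refine ⟨(measurable_blockMean x p q).aestronglyMeasurable, ?_⟩
  rw [hasFiniteIntegral_iff_ofReal (ae_of_all _ (blockMean_nonneg x p q)), lintegral_blockMean hx]
  exact ENNReal.ofReal_lt_top

theorem integral_blockMean (hx : ∀ i < C, x i ≤ x (i + 1)) :
    ∫ B, blockMean x p q B ∂(blockLaw C) = geomMeanConst * cellNorm x p q C := by
  rw [integral_eq_lintegral_of_nonneg_ae (ae_of_all _ (blockMean_nonneg x p q))
    (measurable_blockMean x p q).aestronglyMeasurable, lintegral_blockMean hx,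
    ENNReal.toReal_ofReal]
  exact mul_nonneg (by linarith [one_le_geomMeanConst]) (cellNorm_nonneg hx)

theorem integrable_blockMean_sq (hx : ∀ i < C, x i ≤ x (i + 1)) :
    Integrable (fun B => blockMean x p q B ^ 2) (blockLaw C) := by
  refine ⟨((measurable_blockMean x p q).pow_const 2).aestronglyMeasurable, ?_⟩
  rw [hasFiniteIntegral_iff_ofReal (ae_of_all _ fun _ => sq_nonneg _)]
  exact (lintegral_blockMean_sq_le hx).trans_lt ENNReal.ofReal_lt_top

theorem integral_blockMean_sq_le (hx : ∀ i < C, x i ≤ x (i + 1)) :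
    ∫ B, blockMean x p q B ^ 2 ∂(blockLaw C) ≤ 64 * cellNorm x p q C ^ 2 := by
  rw [integral_eq_lintegral_of_nonneg_ae (ae_of_all _ fun _ => sq_nonneg _)
    ((measurable_blockMean x p q).pow_const 2).aestronglyMeasurable]
  refine ENNReal.toReal_le_of_le_ofReal (by positivity) (lintegral_blockMean_sq_le hx)

end

/-! ### Chernoff bounds for sums of truncated variables. -/

section Chernoff

variable {X : Type*} [MeasurableSpace X] (ν : Measure X) [IsProbabilityMeasure ν]

theorem chernoff_pi (N : ℕ) {f : X → ℝ} (hf : Measurable f) (M s : ℝ)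
    (hM : ∫⁻ a, ENNReal.ofReal (Real.exp (f a)) ∂ν ≤ ENNReal.ofReal (Real.exp M)) :
    (Measure.pi fun _ : Fin N => ν) {ω | s ≤ ∑ r, f (ω r)} ≤
      ENNReal.ofReal (Real.exp (N * M - s)) := by
  have hset : {ω : Fin N → X | s ≤ ∑ r, f (ω r)} ⊆
      {ω | ENNReal.ofReal (Real.exp s) ≤ ∏ r, ENNReal.ofReal (Real.exp (f (ω r)))} := by
    intro ω hω
    simp only [Set.mem_ofPred_eq] at hω ⊢
    rw [← ENNReal.ofReal_prod_of_nonneg fun _ _ => Real.exp_nonneg _, ← Real.exp_sum]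
    exact ENNReal.ofReal_le_ofReal (Real.exp_le_exp.mpr hω)
  have hs : ENNReal.ofReal (Real.exp s) ≠ 0 := by simp [Real.exp_pos]
  refine (measure_mono hset).trans ((meas_ge_le_lintegral_div
    (Measurable.aemeasurable (by fun_prop)) hs ENNReal.ofReal_ne_top).trans ?_)
  rw [lintegral_pi_prod ν (f := fun a => ENNReal.ofReal (Real.exp (f a))) (by fun_prop),
    Fintype.card_fin]
  refine (ENNReal.div_le_div_right (pow_le_pow_left' hM N) _).trans ?_
  rw [← ENNReal.ofReal_pow (Real.exp_nonneg _), ← Real.exp_nat_mul,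
    ← ENNReal.ofReal_div_of_pos (Real.exp_pos _), ← Real.exp_sub]

theorem Real.exp_le_one_add_self_add_sq {x : ℝ} (h0 : 0 ≤ x) (h1 : x ≤ 1) :
    Real.exp x ≤ 1 + x + x ^ 2 := by
  have h := Real.abs_exp_sub_one_sub_id_le (x := x) (by rwa [abs_of_nonneg h0])
  have := (abs_le.mp h).2
  linarith

theorem Real.exp_neg_le_one_sub_self_add_sq {x : ℝ} (h0 : 0 ≤ x) :
    Real.exp (-x) ≤ 1 - x + x ^ 2 / 2 := by
  have hmono : MonotoneOn (fun t : ℝ => 1 - t + t ^ 2 / 2 - Real.exp (-t)) (Set.Ici 0) := by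
    refine monotoneOn_of_deriv_nonneg (convex_Ici 0) (by fun_prop) (by fun_prop) fun t _ => ?_
    have : HasDerivAt (fun t : ℝ => 1 - t + t ^ 2 / 2 - Real.exp (-t)) (-1 + t + Real.exp (-t)) t := by
      have h1 := ((hasDerivAt_id t).const_sub 1).add ((hasDerivAt_pow 2 t).div_const 2)
      have h2 := (Real.hasDerivAt_exp (-t)).comp t (hasDerivAt_neg t)
      convert! h1.sub h2 using 1
      simp
    rw [this.deriv]
    linarith [Real.add_one_le_exp (-t)]
  have := hmono (Set.mem_Ici.mpr le_rfl) (Set.mem_Ici.mpr h0) h0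
  simp at this
  linarith

variable {ν}

/-- Truncation keeps the exponent at most 1, where `exp x ≤ 1 + x + x²`. For an upper tail the
truncation is harmless, since it only lowers the moments. -/
theorem lintegral_exp_truncation_le {y : X → ℝ} (hy : ∀ a, 0 ≤ y a)
    (hi : Integrable y ν) (hi2 : Integrable (fun a => y a ^ 2) ν) {lam T : ℝ} (hl : 0 ≤ lam)
    (hT : 0 ≤ T) (hlT : lam * T ≤ 1) :
    ∫⁻ a, ENNReal.ofReal (Real.exp (lam * min (y a) T)) ∂ν ≤
      ENNReal.ofReal (Real.exp (lam * ∫ a, y a ∂ν + lam ^ 2 * ∫ a, y a ^ 2 ∂ν)) := by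
  have hb : ∀ a, Real.exp (lam * min (y a) T) ≤ 1 + lam * y a + lam ^ 2 * y a ^ 2 := by
    intro a
    have h0 : 0 ≤ min (y a) T := le_min (hy a) hT
    have h1 : lam * min (y a) T ≤ 1 :=
      (mul_le_mul_of_nonneg_left (min_le_right _ _) hl).trans hlT
    have h2 : lam * min (y a) T ≤ lam * y a := mul_le_mul_of_nonneg_left (min_le_left _ _) hl
    refine (Real.exp_le_one_add_self_add_sq (by positivity) h1).trans ?_
    rw [← mul_pow]
    have h3 : (lam * min (y a) T) ^ 2 ≤ (lam * y a) ^ 2 := by gcongr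
    linarith
  have hint1 : Integrable (fun a => 1 + lam * y a) ν := (integrable_const 1).add (hi.const_mul _)
  have hint : Integrable (fun a => 1 + lam * y a + lam ^ 2 * y a ^ 2) ν :=
    ((integrable_const 1).add (hi.const_mul _)).add (hi2.const_mul _)
  refine (lintegral_mono fun a => ENNReal.ofReal_le_ofReal (hb a)).trans ?_
  rw [← ofReal_integral_eq_lintegral_ofReal hint (ae_of_all _ fun a => by
    have := hy a; positivity)]
  apply ENNReal.ofReal_le_ofReal
  rw [integral_add hint1 (hi2.const_mul _),
    integral_add (integrable_const 1) (hi.const_mul _), integral_const_mul, integral_const_mul]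
  simp only [integral_const, probReal_univ, smul_eq_mul, mul_one]
  have := Real.add_one_le_exp (lam * ∫ a, y a ∂ν + lam ^ 2 * ∫ a, y a ^ 2 ∂ν)
  linarith

/-- For a lower tail the truncation costs mean, but `min y T ≥ y - y² / T` bounds the loss by the
second moment. The bound for `exp (-x)` holds for all `x ≥ 0`, so `lam * T` is unrestricted. -/
theorem lintegral_exp_neg_truncation_le {y : X → ℝ} (hy : ∀ a, 0 ≤ y a)
    (hi : Integrable y ν) (hi2 : Integrable (fun a => y a ^ 2) ν) {lam T : ℝ} (hl : 0 ≤ lam)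
    (hT : 0 < T) :
    ∫⁻ a, ENNReal.ofReal (Real.exp (-(lam * min (y a) T))) ∂ν ≤
      ENNReal.ofReal (Real.exp (-(lam * ∫ a, y a ∂ν) +
        (lam / T + lam ^ 2 / 2) * ∫ a, y a ^ 2 ∂ν)) := by
  have hb : ∀ a, Real.exp (-(lam * min (y a) T)) ≤
      1 - lam * y a + (lam / T + lam ^ 2 / 2) * y a ^ 2 := by
    intro a
    have h0 : 0 ≤ min (y a) T := le_min (hy a) hT.le
    refine (Real.exp_neg_le_one_sub_self_add_sq (by positivity)).trans ?_
    have h3 : (lam * min (y a) T) ^ 2 ≤ (lam * y a) ^ 2 := by gcongr; exact min_le_left _ _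
    have h4 : y a - y a ^ 2 / T ≤ min (y a) T := by
      refine le_min (by have := hy a; linarith [show 0 ≤ y a ^ 2 / T by positivity]) ?_
      rw [sub_le_iff_le_add, ← sub_nonneg]
      -- Completing the square in `T² - T y + y²`.
      have : T + y a ^ 2 / T - y a = ((y a - T / 2) ^ 2 + 3 / 4 * T ^ 2) / T := by
        field_simp; ring
      rw [this]; positivity
    have h5 := mul_le_mul_of_nonneg_left h4 hl
    have h6 : lam * (y a - y a ^ 2 / T) = lam * y a - lam / T * y a ^ 2 := by ring
    nlinarith
  have hint1 : Integrable (fun a => 1 - lam * y a) ν := (integrable_const 1).sub (hi.const_mul _)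
  have hint : Integrable (fun a => 1 - lam * y a + (lam / T + lam ^ 2 / 2) * y a ^ 2) ν :=
    ((integrable_const 1).sub (hi.const_mul _)).add (hi2.const_mul _)
  refine (lintegral_mono fun a => ENNReal.ofReal_le_ofReal (hb a)).trans ?_
  rw [← ofReal_integral_eq_lintegral_ofReal hint (ae_of_all _ fun a =>
    (Real.exp_nonneg _).trans (hb a))]
  apply ENNReal.ofReal_le_ofReal
  rw [integral_add hint1 (hi2.const_mul _),
    integral_sub (integrable_const 1) (hi.const_mul _), integral_const_mul, integral_const_mul]
  simp only [integral_const, probReal_univ, smul_eq_mul, mul_one]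
  have := Real.add_one_le_exp (-(lam * ∫ a, y a ∂ν) +
    (lam / T + lam ^ 2 / 2) * ∫ a, y a ^ 2 ∂ν)
  linarith

end Chernoff

/-! ### The truncated mean with a data-dependent level. -/

/-- The truncated mean of `y 0, …, y (N - 1)`, with a truncation level proportional to the
geometric mean of these numbers. -/
noncomputable def truncatedMean (N : ℕ) (ε : ℝ) (y : ℕ → ℝ) : ℝ :=
  (∑ r ∈ Finset.range N,
    min (y r) (6144 * Real.exp ((∑ r ∈ Finset.range N, Real.log (y r)) / N) / ε)) / N *
    ((3 + 2 * Real.sqrt 2) / 8)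

theorem truncatedMean_congr {N : ℕ} (ε : ℝ) {y z : ℕ → ℝ} (h : ∀ r < N, y r = z r) :
    truncatedMean N ε y = truncatedMean N ε z := by
  have h1 : ∀ g : ℝ → ℝ, ∑ r ∈ Finset.range N, g (y r) = ∑ r ∈ Finset.range N, g (z r) := fun g =>
    Finset.sum_congr rfl fun r hr => by rw [h r (Finset.mem_range.mp hr)]
  unfold truncatedMean
  rw [h1 Real.log, h1 fun u => min u _]

/-- The deterministic part. By `e1` and `e2` the pilot estimate lies between `d/24` and `24d`, so
the truncation level `6144 * D0 / ε` lies between `256 d / ε` and `147456 d / ε`, where `6144 = 24 *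
256` and `147456 = 24 * 6144`. Monotonicity in the level then transfers the bounds `e3` and `e4`,
which concern fixed levels. -/
theorem truncatedMean_isApprox {N : ℕ} (hN : 0 < N) {ε d : ℝ} (h0 : 0 < ε) (h1 : ε ≤ 1)
    (hd : 0 < d) (y : ℕ → ℝ)
    (e1 : ∑ r ∈ Finset.range N, Real.log (y r) ≤ N * Real.log (24 * d))
    (e2 : N * Real.log (d / 24) ≤ ∑ r ∈ Finset.range N, Real.log (y r))
    (e3 : ∑ r ∈ Finset.range N, min (y r) (147456 * d / ε) ≤
      N * (geomMeanConst * d * (1 + ε / 2)))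
    (e4 : N * (geomMeanConst * d * (1 - ε / 2)) ≤
      ∑ r ∈ Finset.range N, min (y r) (256 * d / ε)) :
    (1 - ε) * truncatedMean N ε y ≤ d ∧ d ≤ (1 + ε) * truncatedMean N ε y := by
  have hN' : (0 : ℝ) < N := by exact_mod_cast hN
  unfold truncatedMean
  set D0 := Real.exp ((∑ r ∈ Finset.range N, Real.log (y r)) / N) with hD0
  have u1 : D0 ≤ 24 * d := by
    rw [← Real.exp_log (show 0 < 24 * d by positivity), hD0, Real.exp_le_exp, div_le_iff₀ hN']
    linarith
  have u2 : d / 24 ≤ D0 := by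
    rw [← Real.exp_log (show 0 < d / 24 by positivity), hD0, Real.exp_le_exp, le_div_iff₀ hN']
    linarith
  have t1 : 6144 * D0 / ε ≤ 147456 * d / ε := div_le_div_of_nonneg_right (by linarith) h0.le
  have t2 : 256 * d / ε ≤ 6144 * D0 / ε := div_le_div_of_nonneg_right (by linarith) h0.le
  have hK := one_le_geomMeanConst
  have hKi : (3 + 2 * Real.sqrt 2) / 8 = 1 / geomMeanConst := by
    unfold geomMeanConst; rw [one_div_div]
  set S := ∑ r ∈ Finset.range N, min (y r) (6144 * D0 / ε)
  have s1 : S ≤ N * (geomMeanConst * d * (1 + ε / 2)) :=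
    (Finset.sum_le_sum fun r _ => min_le_min le_rfl t1).trans e3
  have s2 : N * (geomMeanConst * d * (1 - ε / 2)) ≤ S :=
    e4.trans (Finset.sum_le_sum fun r _ => min_le_min le_rfl t2)
  rw [hKi]
  have v : S / N * (1 / geomMeanConst) = S / (N * geomMeanConst) := by
    field_simp
  rw [v]
  have hp : 0 < N * geomMeanConst := by positivity
  have w1 : S / (N * geomMeanConst) ≤ d * (1 + ε / 2) := by
    rw [div_le_iff₀ hp]; linarith
  have w2 : d * (1 - ε / 2) ≤ S / (N * geomMeanConst) := by
    rw [le_div_iff₀ hp]; linarith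
  constructor
  -- Error `ε/2` around `d` is enough: `(1 - ε)(1 + ε/2) ≤ 1 ≤ (1 + ε)(1 - ε/2)` for `0 < ε ≤ 1`.
  · calc (1 - ε) * (S / (N * geomMeanConst)) ≤ (1 - ε) * (d * (1 + ε / 2)) := by
          apply mul_le_mul_of_nonneg_left w1; linarith
      _ ≤ d := by nlinarith [mul_pos hd h0, mul_pos (mul_pos hd h0) h0]
  · calc d ≤ (1 + ε) * (d * (1 - ε / 2)) := by
          nlinarith [mul_nonneg (mul_pos hd h0).le (sub_nonneg.mpr h1)]
      _ ≤ _ := by apply mul_le_mul_of_nonneg_left w2; linarith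

/-- Each of the four conditions of `truncatedMean_isApprox` fails with probability at most the same
exponential. The two pilot conditions fail with probability at most `exp (-N)`; the rate is dictated
by the upper tail at the large level, as `589824 = 4 * 147456`. -/
theorem pi_truncatedMean_blockMean_le {C N : ℕ} (hN : 0 < N) {ε : ℝ} (h0 : 0 < ε) (h1 : ε ≤ 1)
    {x p q : ℕ → ℝ} (hx : ∀ i < C, x i ≤ x (i + 1)) (hd : 0 < cellNorm x p q C) :
    (Measure.pi fun _ : Fin N => blockLaw C) {B | ∀ y : ℕ → ℝ,
      (∀ r : Fin N, y r = blockMean x p q (B r)) →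
      ¬ ((1 - ε) * truncatedMean N ε y ≤ cellNorm x p q C ∧
        cellNorm x p q C ≤ (1 + ε) * truncatedMean N ε y)} ≤
      ENNReal.ofReal (4 * Real.exp (-(N * ε ^ 2 / 589824))) := by
  set d := cellNorm x p q C
  set K := geomMeanConst with hKdef
  have hK1 : 1 ≤ K := one_le_geomMeanConst
  have hK2 : K ≤ 7 / 5 := geomMeanConst_le
  have hm := measurable_blockMean (C := C) x p q
  have hy := blockMean_nonneg (C := C) x p q
  have hi := integrable_blockMean (p := p) (q := q) hx
  have hi2 := integrable_blockMean_sq (p := p) (q := q) hx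
  have hI : ∫ B, blockMean x p q B ∂(blockLaw C) = K * d := integral_blockMean hx
  have hI2 : ∫ B, blockMean x p q B ^ 2 ∂(blockLaw C) ≤ 64 * d ^ 2 := integral_blockMean_sq_le hx
  have hN' : (1 : ℝ) ≤ N := by exact_mod_cast hN
  have hε2 : ε ^ 2 ≤ 1 := by nlinarith
  have hfin : ∀ z : ℝ, z ≤ -(N * ε ^ 2 / 589824) → ENNReal.ofReal (Real.exp z) ≤
      ENNReal.ofReal (Real.exp (-(N * ε ^ 2 / 589824))) := fun z hz =>
    ENNReal.ofReal_le_ofReal (Real.exp_le_exp.mpr hz)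
  have hNn : -(N : ℝ) ≤ -(N * ε ^ 2 / 589824) := by nlinarith
  have hexp1 : Real.exp 1 < 2.7182818286 := Real.exp_one_lt_d9
  -- A finite inverse moment excludes the value 0, where `log` has the default value 0 and `exp (log
  -- y) = y` fails.
  have hpos : ∀ᵐ B ∂(blockLaw C), 0 < blockMean x p q B := by
    have h := ae_lt_top (μ := blockLaw C) (f := fun B => (ENNReal.ofReal (blockMean x p q B))⁻¹)
      (by fun_prop) ((lintegral_inv_blockMean_le hx hd).trans_lt ENNReal.ofReal_lt_top).ne
    filter_upwards [h] with B hB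
    simpa using hB
  -- The exponential moments of `log y` and `-log y` are the mean and the inverse moment of `y`. The
  -- factor 24 makes both ratios, `geomMeanConst / 24` and `(17/2) / 24`, smaller than `1/e`.
  have E1 := chernoff_pi (blockLaw C) N (f := fun B => Real.log (blockMean x p q B))
    (by fun_prop) (Real.log (K * d)) (N * Real.log (24 * d)) (by
      rw [Real.exp_log (by positivity), ← lintegral_blockMean hx]
      refine (lintegral_congr_ae ?_).le
      filter_upwards [hpos] with B hB
      rw [Real.exp_log hB])
  have E2 := chernoff_pi (blockLaw C) N (f := fun B => -Real.log (blockMean x p q B))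
    (by fun_prop) (Real.log (17 / 2 / d)) (-(N * Real.log (d / 24))) (by
      rw [Real.exp_log (by positivity)]
      refine le_trans (lintegral_congr_ae ?_).le (lintegral_inv_blockMean_le hx hd)
      filter_upwards [hpos] with B hB
      rw [Real.exp_neg, Real.exp_log hB, ENNReal.ofReal_inv_of_pos hB])
  -- In both truncated sums the parameter is the reciprocal of the truncation level.
  have E3 := chernoff_pi (blockLaw C) N
    (f := fun B => (ε / (147456 * d)) * min (blockMean x p q B) (147456 * d / ε))
    (by fun_prop) _ ((ε / (147456 * d)) * (N * (K * d * (1 + ε / 2))))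
    (lintegral_exp_truncation_le hy hi hi2 (by positivity) (by positivity)
      (by field_simp; exact le_rfl))
  have E4 := chernoff_pi (blockLaw C) N
    (f := fun B => -((ε / (256 * d)) * min (blockMean x p q B) (256 * d / ε)))
    (by fun_prop) _ (-((ε / (256 * d)) * (N * (K * d * (1 - ε / 2)))))
    (lintegral_exp_neg_truncation_le hy hi hi2 (by positivity) (by positivity))
  replace E1 := E1.trans (hfin _ (by
    have : Real.log (K * d) - Real.log (24 * d) ≤ -1 := by
      rw [← Real.log_div (by positivity) (by positivity), Real.log_le_iff_le_exp (by positivity),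
        Real.exp_neg, div_le_iff₀ (by positivity), inv_mul_eq_div, le_div_iff₀ (by positivity)]
      nlinarith [mul_pos hd (Real.exp_pos 1)]
    nlinarith))
  replace E2 := E2.trans (hfin _ (by
    have : Real.log (17 / 2 / d) + Real.log (d / 24) ≤ -1 := by
      rw [← Real.log_mul (by positivity) (by positivity), Real.log_le_iff_le_exp (by positivity),
        Real.exp_neg, show 17 / 2 / d * (d / 24) = 17 / 48 by field_simp; norm_num,
        le_inv_comm₀ (by norm_num) (Real.exp_pos 1)]
      norm_num at hexp1 ⊢
      linarith
    nlinarith))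
  replace E3 := E3.trans (hfin _ (by
    rw [hI]
    have h64 := mul_le_mul_of_nonneg_left hI2 (sq_nonneg (ε / (147456 * d)))
    have e1 : (ε / (147456 * d)) ^ 2 * (64 * d ^ 2) = ε ^ 2 * (64 / 147456 ^ 2) := by
      field_simp
    have e2 : ε / (147456 * d) * (N * (K * d * (1 + ε / 2))) =
        N * (ε / (147456 * d) * (K * d)) + N * (K * (ε ^ 2 / 294912)) := by
      field_simp; ring
    rw [e1] at h64
    rw [e2]
    have h5 : ε ^ 2 / 294912 ≤ K * (ε ^ 2 / 294912) := le_mul_of_one_le_left (by positivity) hK1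
    have h6 : (ε / (147456 * d)) ^ 2 * ∫ B, blockMean x p q B ^ 2 ∂(blockLaw C) -
        K * (ε ^ 2 / 294912) ≤ -(ε ^ 2 / 589824) := by nlinarith [sq_nonneg ε]
    nlinarith [mul_le_mul_of_nonneg_left h6 (show (0 : ℝ) ≤ N by positivity)]))
  replace E4 := E4.trans (hfin _ (by
    rw [hI]
    have h64 := mul_le_mul_of_nonneg_left hI2
      (show 0 ≤ ε / (256 * d) / (256 * d / ε) + (ε / (256 * d)) ^ 2 / 2 by positivity)
    have e1 : (ε / (256 * d) / (256 * d / ε) + (ε / (256 * d)) ^ 2 / 2) * (64 * d ^ 2) =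
        ε ^ 2 * (3 / 2048) := by
      field_simp; norm_num
    have e2 : ε / (256 * d) * (N * (K * d * (1 - ε / 2))) =
        N * (ε / (256 * d) * (K * d)) - N * (K * (ε ^ 2 / 512)) := by
      field_simp
      ring
    rw [e1] at h64
    rw [e2]
    have h5 : ε ^ 2 / 512 ≤ K * (ε ^ 2 / 512) := le_mul_of_one_le_left (by positivity) hK1
    have h6 : (ε / (256 * d) / (256 * d / ε) + (ε / (256 * d)) ^ 2 / 2) *
        ∫ B, blockMean x p q B ^ 2 ∂(blockLaw C) - K * (ε ^ 2 / 512) ≤ -(ε ^ 2 / 589824) := by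
      nlinarith [sq_nonneg ε]
    nlinarith [mul_le_mul_of_nonneg_left h6 (show (0 : ℝ) ≤ N by positivity)]))
  have h4 : ENNReal.ofReal (4 * Real.exp (-(N * ε ^ 2 / 589824))) =
      ENNReal.ofReal (Real.exp (-(N * ε ^ 2 / 589824))) +
      ENNReal.ofReal (Real.exp (-(N * ε ^ 2 / 589824))) +
      ENNReal.ofReal (Real.exp (-(N * ε ^ 2 / 589824))) +
      ENNReal.ofReal (Real.exp (-(N * ε ^ 2 / 589824))) := by
    rw [ENNReal.ofReal_mul (by norm_num)]
    norm_num
    ring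
  rw [h4]
  refine le_trans (measure_mono ?_) ((measure_union_le _ _).trans (add_le_add
    ((measure_union_le _ _).trans (add_le_add ((measure_union_le _ _).trans (add_le_add E1 E2))
      E3)) E4))
  intro B hB
  simp only [Set.mem_union, Set.mem_ofPred_eq] at hB ⊢
  by_contra! hcon
  obtain ⟨⟨⟨c1, c2⟩, c3⟩, c4⟩ := hcon
  -- Only the first `N` terms enter the truncated mean, so the extension by 0 is immaterial.
  refine hB (fun r => if h : r < N then blockMean x p q (B ⟨r, h⟩) else 0) (fun r => by simp) ?_
  have hsum : ∀ g : ℝ → ℝ, ∑ r ∈ Finset.range N,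
      g (if h : r < N then blockMean x p q (B ⟨r, h⟩) else 0) = ∑ r, g (blockMean x p q (B r)) := by
    intro g
    rw [← Fin.sum_univ_eq_sum_range
      (fun r => g (if h : r < N then blockMean x p q (B ⟨r, h⟩) else 0))]
    simp
  have hl3 : 0 < ε / (147456 * d) := by positivity
  have hl4 : 0 < ε / (256 * d) := by positivity
  refine truncatedMean_isApprox hN h0 h1 hd _ ?_ ?_ ?_ ?_
  · rw [hsum Real.log]; exact c1.le
  · rw [hsum Real.log]
    rw [Finset.sum_neg_distrib] at c2
    linarith
  · rw [hsum fun z => min z (147456 * d / ε)]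
    rw [← Finset.mul_sum] at c3
    exact (lt_of_mul_lt_mul_left c3 hl3.le).le
  · rw [hsum fun z => min z (256 * d / ε)]
    rw [Finset.sum_neg_distrib, ← Finset.mul_sum, neg_lt_neg_iff] at c4
    exact (lt_of_mul_lt_mul_left c4 hl4.le).le

/-! ### The random tape as a sequence of independent blocks. -/

/-- The random numbers of the `r`-th repetition. -/
def tapeBlock (C : ℕ) (ω : RealRAM.Tape) (r : ℕ) : Block C := fun g k =>
  ω ((r * 5 + g) * (C * 2) + (k.1 * 2 + k.2))

/-- The tape positions are row-major indices, hence distinct, so the selected numbers are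
independent and uniform. Currying the product measure twice gives the nested form. -/
theorem map_tapeBlock (C N : ℕ) :
    RealRAM.tapeLaw.map (fun ω (r : Fin N) => tapeBlock C ω r) =
      Measure.pi fun _ => blockLaw C := by
  let e : (Fin N × Fin 5) × (Fin C × Fin 2) → ℕ := fun k =>
    (k.1.1 * 5 + k.1.2) * (C * 2) + (k.2.1 * 2 + k.2.2)
  have he : Function.Injective e := by
    have : e = fun k => ((finProdFinEquiv (finProdFinEquiv k.1, finProdFinEquiv k.2) :
        Fin ((N * 5) * (C * 2))) : ℕ) := by
      ext k
      simp only [e, finProdFinEquiv_apply_val]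
      ring
    rw [this]
    intro k l hkl
    have h1 := finProdFinEquiv.injective (Fin.ext hkl)
    simp only [Prod.mk.injEq, EmbeddingLike.apply_eq_iff_eq] at h1
    exact Prod.ext h1.1 h1.2
  have h1 := Measure.map_infinitePi_infinitePi_of_inj
    (P := fun _ : ℕ => (volume : Measure unitInterval)) he
  have h2 := Measure.infinitePi_map_curry
    (fun (_ : Fin N × Fin 5) (_ : Fin C × Fin 2) => (volume : Measure unitInterval))
  have h3 := Measure.infinitePi_map_curry (fun (_ : Fin N) (_ : Fin 5) =>
    (Measure.infinitePi fun _ : Fin C × Fin 2 => (volume : Measure unitInterval)))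
  rw [← h1, Measure.map_map (by fun_prop) (by fun_prop)] at h2
  rw [← h2, Measure.map_map (by fun_prop) (by fun_prop)] at h3
  simp only [Measure.infinitePi_eq_pi] at h3
  exact h3

/-- Pushing forward along the block map. The inequality `Measure.le_map_apply` avoids proving that
the bad set is measurable. -/
theorem tapeLaw_truncatedMean_blockMean_le {C N : ℕ} (hN : 0 < N) {ε : ℝ} (h0 : 0 < ε)
    (h1 : ε ≤ 1) {x p q : ℕ → ℝ} (hx : ∀ i < C, x i ≤ x (i + 1)) (hd : 0 < cellNorm x p q C) :
    RealRAM.tapeLaw {ω |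
      ¬ ((1 - ε) * truncatedMean N ε (fun r => blockMean x p q (tapeBlock C ω r)) ≤
          cellNorm x p q C ∧ cellNorm x p q C ≤
        (1 + ε) * truncatedMean N ε (fun r => blockMean x p q (tapeBlock C ω r)))} ≤
      ENNReal.ofReal (4 * Real.exp (-(N * ε ^ 2 / 589824))) := by
  refine le_trans ?_ (pi_truncatedMean_blockMean_le hN h0 h1 hx hd)
  rw [← map_tapeBlock]
  refine le_trans (measure_mono ?_) (Measure.le_map_apply (Measurable.aemeasurable ?_) _)
  · intro ω hω y hy
    rw [truncatedMean_congr ε (z := fun r => blockMean x p q (tapeBlock C ω r))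
      fun r hr => hy ⟨r, hr⟩]
    exact hω
  · unfold tapeBlock; fun_prop

/-! ### Hoare-style rules with cost bounds. -/

namespace RealRAM

/-- Started in `σ`, the program `P` halts after at most `B` operations, in a state with the
property `Q`. -/
def Halts (ω : Tape) (P : Prog) (σ : State) (B : ℕ) (Q : State → Prop) : Prop :=
  ∃ k τ, Run ω P σ k τ ∧ k ≤ B ∧ Q τ

section

variable {ω : Tape} {P P' : Prog} {σ : State} {A B B' : ℕ} {i e : NExpr} {f : RExpr} {t : BExpr}
  {Q R : State → Prop}

theorem Halts.mono (h : Halts ω P σ B Q) (hB : B ≤ B') (hQ : ∀ τ, Q τ → R τ) :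
    Halts ω P σ B' R := by
  obtain ⟨k, τ, h1, h2, h3⟩ := h
  exact ⟨k, τ, h1, h2.trans hB, hQ τ h3⟩

theorem Halts.le (h : Halts ω P σ B Q) (hB : B ≤ B') : Halts ω P σ B' Q := h.mono hB fun _ => id

theorem Halts.seq (h : Halts ω P σ B Q) (h' : ∀ τ, Q τ → Halts ω P' τ B' R) :
    Halts ω (.seq P P') σ (B + B') R := by
  obtain ⟨k, τ, h1, h2, h3⟩ := h
  obtain ⟨l, υ, h4, h5, h6⟩ := h' τ h3
  exact ⟨k + l, υ, .seq h1 h4, by omega, h6⟩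

theorem Halts.nset (h : Q (σ.setNat A (i.eval σ) (e.eval σ))) :
    Halts ω (.nset A i e) σ (i.cost + e.cost + 1) Q := ⟨_, _, .nset A i e σ, le_rfl, h⟩

theorem Halts.rset (h : Q (σ.setReal A (i.eval σ) (f.eval σ))) :
    Halts ω (.rset A i f) σ (i.cost + f.cost + 1) Q := ⟨_, _, .rset A i f σ, le_rfl, h⟩

theorem Halts.draw (h : Q { σ.setReal A (i.eval σ) (ω σ.used : ℝ) with used := σ.used + 1 }) :
    Halts ω (.draw A i) σ (i.cost + 1) Q := ⟨_, _, .draw A i σ, le_rfl, h⟩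

theorem Halts.nset_seq (h : Halts ω P (σ.setNat A (i.eval σ) (e.eval σ)) B Q) :
    Halts ω (.seq (.nset A i e) P) σ (i.cost + e.cost + 1 + B) Q :=
  Halts.seq (Halts.nset (Q := (· = _)) rfl) fun _ hτ => hτ ▸ h

theorem Halts.rset_seq (h : Halts ω P (σ.setReal A (i.eval σ) (f.eval σ)) B Q) :
    Halts ω (.seq (.rset A i f) P) σ (i.cost + f.cost + 1 + B) Q :=
  Halts.seq (Halts.rset (Q := (· = _)) rfl) fun _ hτ => hτ ▸ h

theorem Halts.draw_seq
    (h : Halts ω P { σ.setReal A (i.eval σ) (ω σ.used : ℝ) with used := σ.used + 1 } B Q) :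
    Halts ω (.seq (.draw A i) P) σ (i.cost + 1 + B) Q :=
  Halts.seq (Halts.draw (Q := (· = _)) rfl) fun _ hτ => hτ ▸ h

theorem Halts.cond (h : t.eval σ → Halts ω P σ B Q) (h' : ¬ t.eval σ → Halts ω P' σ B Q) :
    Halts ω (.cond t P P') σ (t.cost + B + 1) Q := by
  by_cases ht : t.eval σ
  · obtain ⟨k, τ, h1, h2, h3⟩ := h ht
    exact ⟨_, τ, .cond_true ht h1, by omega, h3⟩
  · obtain ⟨k, τ, h1, h2, h3⟩ := h' ht
    exact ⟨_, τ, .cond_false ht h1, by omega, h3⟩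

/-- The invariant is indexed by the iteration and decides the test, so the number of passes is
exactly `n` and termination needs no separate argument. -/
theorem Halts.loop (n : ℕ) (I : ℕ → State → Prop)
    (ht : ∀ j ≤ n, ∀ τ, I j τ → (t.eval τ ↔ j < n))
    (hP : ∀ j < n, ∀ τ, I j τ → Halts ω P τ B (I (j + 1))) (h0 : I 0 σ) :
    Halts ω (.loop t P) σ (n * (B + t.cost + 1) + t.cost + 1) (I n) := by
  have key : ∀ d j, j + d = n → ∀ τ, I j τ →
      Halts ω (.loop t P) τ (d * (B + t.cost + 1) + t.cost + 1) (I n) := by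
    intro d
    induction d with
    | zero =>
      intro j hj τ hτ
      obtain rfl : j = n := by omega
      exact ⟨_, τ, .loop_false fun h => absurd ((ht j le_rfl τ hτ).mp h) (lt_irrefl _),
        by omega, hτ⟩
    | succ d ih =>
      intro j hj τ hτ
      obtain ⟨k, υ, h1, h2, h3⟩ := hP j (by omega) τ hτ
      obtain ⟨l, υ', h4, h5, h6⟩ := ih (j + 1) (by omega) υ h3
      refine ⟨_, υ', .loop_true ((ht j (by omega) τ hτ).mpr (by omega)) h1 h4, ?_, h6⟩
      rw [Nat.succ_mul]
      omega
  exact key n 0 (by omega) σ h0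

end

/-- The variable that is stored in the first cell of the `A`-th array of natural numbers. -/
abbrev nvar (A : ℕ) : NExpr := .get A (.const 0)

/-- The variable that is stored in the first cell of the `A`-th array of real numbers. -/
abbrev rvar (A : ℕ) : RExpr := .get A (.const 0)

/-- Repeat `P` while the variable `A` runs through the numbers smaller than `e`. -/
def Prog.forTo (A : ℕ) (e : NExpr) (P : Prog) : Prog :=
  .seq (.nset A (.const 0) (.const 0))
    (.loop (.nlt (nvar A) e) (.seq P (.nset A (.const 0) (.add (nvar A) (.const 1)))))

/-- The invariant refers to the head of the loop, so the body must establish it for the state after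
the counter has been increased. -/
theorem Halts.forTo {ω : Tape} {A B : ℕ} {e : NExpr} {P : Prog} {σ : State} {Q : State → Prop}
    (n : ℕ) (I : ℕ → State → Prop)
    (ht : ∀ j ≤ n, ∀ τ, I j τ → τ.nat A 0 = j ∧ e.eval τ = n)
    (h0 : I 0 (σ.setNat A 0 0))
    (hP : ∀ j < n, ∀ τ, I j τ → Halts ω P τ B fun υ => I (j + 1) (υ.setNat A 0 (υ.nat A 0 + 1)))
    (hQ : ∀ τ, I n τ → Q τ) :
    Halts ω (.forTo A e P) σ (n * (B + e.cost + 10) + e.cost + 7) Q := by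
  refine Halts.mono (Halts.nset_seq (Halts.loop (B := B + 6) n I ?_ ?_ h0)) ?_ hQ
  · intro j hj τ hτ
    obtain ⟨h1, h2⟩ := ht j hj τ hτ
    simp [BExpr.eval, NExpr.eval, h1, h2]
  · intro j hj τ hτ
    exact Halts.seq (hP j hj τ hτ) fun υ hυ => Halts.nset hυ
  · simp only [NExpr.cost, BExpr.cost]
    have : n * (B + 6 + (1 + 1 + e.cost + 1) + 1) = n * (B + e.cost + 10) := by ring
    omega

/-- Only the arrays of natural numbers in `X` and the arrays of real numbers in `Y` differ. -/
def Frame (X Y : List ℕ) (σ τ : State) : Prop :=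
  (∀ A, A ∉ X → τ.nat A = σ.nat A) ∧ ∀ A, A ∉ Y → τ.real A = σ.real A

theorem Frame.refl (X Y : List ℕ) (σ : State) : Frame X Y σ σ := ⟨fun _ _ => rfl, fun _ _ => rfl⟩

theorem Frame.trans {X Y X' Y' : List ℕ} {σ τ υ : State} (h : Frame X Y σ τ)
    (h' : Frame X' Y' τ υ) (hX : X' ⊆ X) (hY : Y' ⊆ Y) : Frame X Y σ υ :=
  ⟨fun A hA => (h'.1 A fun h => hA (hX h)).trans (h.1 A hA),
    fun A hA => (h'.2 A fun h => hA (hY h)).trans (h.2 A hA)⟩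

theorem Frame.setNat {X Y : List ℕ} {σ τ : State} (h : Frame X Y σ τ) {A : ℕ} (hA : A ∈ X)
    (i v : ℕ) : Frame X Y σ (τ.setNat A i v) := by
  refine ⟨fun B hB => ?_, h.2⟩
  rw [← h.1 B hB]
  funext j
  have : B ≠ A := fun h => hB (h ▸ hA)
  simp [State.setNat, this]

theorem Frame.setReal {X Y : List ℕ} {σ τ : State} (h : Frame X Y σ τ) {A : ℕ} (hA : A ∈ Y)
    (i : ℕ) (v : ℝ) : Frame X Y σ (τ.setReal A i v) := by
  refine ⟨h.1, fun B hB => ?_⟩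
  rw [← h.2 B hB]
  funext j
  have : B ≠ A := fun h => hB (h ▸ hA)
  simp [State.setReal, this]

theorem Frame.setUsed {X Y : List ℕ} {σ τ : State} (h : Frame X Y σ τ) (u : ℕ) :
    Frame X Y σ { τ with used := u } := h

/-- The program variables and the input are unchanged. -/
def HasInput (inp σ : State) : Prop :=
  (∀ A ≤ 2, σ.nat A = inp.nat A) ∧ ∀ A ≤ 3, σ.real A = inp.real A

theorem HasInput.frame {inp σ τ : State} {X Y : List ℕ} (h : HasInput inp σ)
    (hf : Frame X Y σ τ) (hX : ∀ A ∈ X, 2 < A) (hY : ∀ A ∈ Y, 3 < A) : HasInput inp τ :=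
  ⟨fun A hA => (hf.1 A fun h => absurd (hX A h) (by omega)).trans (h.1 A hA),
    fun A hA => (hf.2 A fun h => absurd (hY A h) (by omega)).trans (h.2 A hA)⟩

@[simp] theorem setNat_nat (σ : State) (A i v B j : ℕ) :
    (σ.setNat A i v).nat B j = if B = A ∧ j = i then v else σ.nat B j := rfl

@[simp] theorem setNat_real (σ : State) (A i v : ℕ) : (σ.setNat A i v).real = σ.real := rfl

@[simp] theorem setNat_used (σ : State) (A i v : ℕ) : (σ.setNat A i v).used = σ.used := rfl

@[simp] theorem setReal_nat (σ : State) (A i : ℕ) (v : ℝ) : (σ.setReal A i v).nat = σ.nat := rfl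

@[simp] theorem setReal_real (σ : State) (A i B j : ℕ) (v : ℝ) :
    (σ.setReal A i v).real B j = if B = A ∧ j = i then v else σ.real B j := rfl

@[simp] theorem setReal_used (σ : State) (A i : ℕ) (v : ℝ) : (σ.setReal A i v).used = σ.used := rfl

/-! ### The program: drawing random numbers and computing sketches. -/

/-- The number of cells as an expression. -/
abbrev cellsExpr : NExpr := .sub (.get 0 (.const 2)) (.const 1)

/-- Draw the random numbers that select the quadrature nodes. -/
def drawNodes : Prog :=
  -- The second draw is discarded; it keeps every row at two random numbers per cell, as in `Row`.
  .forTo 6 cellsExpr (.seq (.draw 5 (nvar 6)) (.draw 6 (.const 0)))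

/-- Memory layout of all programs. Naturals: 3 number of repetitions, 4 repetition, 5 sketch within
a repetition, 6 cell, 7 function (first of a pair), 8 piece, 9 second function of a pair. Reals: 4
output, 5 node shifts, 6 scratch, 7 and 8 prefix sums, 9 sketches, 10 sum of logarithms, 11
truncation level, 12 accumulator, 13 current geometric mean, 14 half width of a cell. -/
theorem drawNodes_halts {ω : Tape} {inp σ : State} (hσ : HasInput inp σ) :
    Halts ω drawNodes σ (30 * (inp.nat 0 2 - 1) + 20) fun τ =>
      Frame [6] [5, 6] σ τ ∧ τ.used = σ.used + (inp.nat 0 2 - 1) * 2 ∧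
      ∀ i < inp.nat 0 2 - 1, τ.real 5 i = ω (σ.used + i * 2) := by
  refine Halts.mono (B := (inp.nat 0 2 - 1) * (4 + 2 + 4 + 10) + 4 + 7) (Halts.forTo (B := 6)
    (inp.nat 0 2 - 1) (fun j τ => τ.nat 6 0 = j ∧ Frame [6] [5, 6] σ τ ∧
      τ.used = σ.used + j * 2 ∧ ∀ i < j, τ.real 5 i = ω (σ.used + i * 2)) ?_ ?_ ?_ fun τ hτ => ?_)
    (by omega) fun τ hτ => hτ
  · rintro j hj τ ⟨h1, h2, -⟩
    exact ⟨h1, by simp [NExpr.eval, h2.1 0 (by simp), hσ.1 0 (by simp)]⟩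
  · exact ⟨by simp, (Frame.refl _ _ _).setNat (by simp) _ _, by simp, by simp⟩
  · rintro j hj τ ⟨h1, h2, h3, h4⟩
    refine Halts.le (Halts.draw_seq (Halts.draw ⟨?_, ?_, ?_, ?_⟩)) (by decide)
    · simp [h1]
    · exact ((((h2.setReal (by simp) _ _).setUsed _).setReal (by simp) _ _).setUsed _).setNat
        (by simp) _ _
    · simp [h3]; ring
    · intro i hi
      simp only [NExpr.eval, setNat_real, setReal_real, h1]
      by_cases hij : i = j
      · simp [hij, h3]
      · simp [hij, h4 i (by omega)]
  · exact ⟨hτ.2.1, hτ.2.2.1, hτ.2.2.2⟩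

end RealRAM

namespace RealRAM

/-- The quantile transform of the standard Cauchy distribution as an expression. -/
def cauchyExpr (e : RExpr) : RExpr :=
  -- The number `π` is obtained as `4 * arctan 1`, and the tangent as a quotient.
  .div (.sin (.mul (.mul (.cast (.const 4)) (.arctan (.cast (.const 1))))
      (.sub e (.div (.cast (.const 1)) (.cast (.const 2))))))
    (.cos (.mul (.mul (.cast (.const 4)) (.arctan (.cast (.const 1))))
      (.sub e (.div (.cast (.const 1)) (.cast (.const 2))))))

theorem eval_cauchyExpr (σ : State) (e : RExpr) (u : unitInterval) (h : e.eval σ = u) :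
    (cauchyExpr e).eval σ = cauchyQuantile u := by
  have hpi : 4 * (Real.pi / 4) = Real.pi := by ring
  simp [cauchyExpr, RExpr.eval, NExpr.eval, h, hpi, cauchyQuantile, Real.tan_eq_sin_div_cos]

/-- The sum of the weighted Cauchy variables over the first `i` cells. -/
noncomputable def prefixMass (a : ℕ → ℝ) (Z : ℕ → ℕ → ℝ) (i : ℕ) : ℝ :=
  ∑ k ∈ Finset.range i, (a (k + 1) - a k) / 2 * (Z k 0 + Z k 1)

/-- The sum of the weighted Cauchy variables times the quadrature nodes over the first `i` cells. -/
noncomputable def prefixMoment (a θ : ℕ → ℝ) (Z : ℕ → ℕ → ℝ) (i : ℕ) : ℝ :=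
  ∑ k ∈ Finset.range i, (a (k + 1) - a k) / 2 *
    (node (a k) (a (k + 1)) (θ k) 0 * Z k 0 + node (a k) (a (k + 1)) (θ k) 1 * Z k 1)

/-- The Cauchy variables made from the random numbers from number `u` on. -/
noncomputable def tapeCauchy (ω : Tape) (u i z : ℕ) : ℝ := cauchyQuantile (ω (u + (i * 2 + z)))

/-- Draw Cauchy variables and compute the prefix sums. -/
def drawPrefix : Prog :=
  .seq (.rset 7 (.const 0) (.cast (.const 0))) <| .seq (.rset 8 (.const 0) (.cast (.const 0))) <|
  .forTo 6 cellsExpr <|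
  .seq (.draw 6 (.const 0)) <| .seq (.draw 6 (.const 1)) <|
  .seq (.rset 6 (.const 0) (cauchyExpr (.get 6 (.const 0)))) <|
  .seq (.rset 6 (.const 1) (cauchyExpr (.get 6 (.const 1)))) <|
  .seq (.rset 14 (.const 0) (.div (.sub (.get 1 (.add (nvar 6) (.const 1))) (.get 1 (nvar 6)))
    (.cast (.const 2)))) <|
  .seq (.rset 7 (.add (nvar 6) (.const 1)) (.add (.get 7 (nvar 6)) (.mul (rvar 14)
    (.add (.get 6 (.const 0)) (.get 6 (.const 1)))))) <|
  .rset 8 (.add (nvar 6) (.const 1)) (.add (.get 8 (nvar 6)) (.mul (rvar 14)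
    (.add (.mul (.add (.get 1 (nvar 6)) (.mul (rvar 14) (.add (.get 5 (nvar 6))
        (.cast (.const 0))))) (.get 6 (.const 0)))
      (.mul (.add (.get 1 (nvar 6)) (.mul (rvar 14) (.add (.get 5 (nvar 6))
        (.cast (.const 1))))) (.get 6 (.const 1))))))

/-- Two prefix sums are enough, since on a piece the function is a combination of 1 and `x`: one
sums the random weights, the other the weights times the nodes. -/
theorem drawPrefix_halts {ω : Tape} {inp σ : State} (hσ : HasInput inp σ) :
    Halts ω drawPrefix σ (300 * (inp.nat 0 2 - 1) + 50) fun τ =>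
      Frame [6] [6, 7, 8, 14] σ τ ∧ τ.used = σ.used + (inp.nat 0 2 - 1) * 2 ∧
      ∀ i ≤ inp.nat 0 2 - 1, τ.real 7 i = prefixMass (inp.real 1) (tapeCauchy ω σ.used) i ∧
        τ.real 8 i = prefixMoment (inp.real 1) (σ.real 5) (tapeCauchy ω σ.used) i := by
  refine Halts.mono (B := 4 + (4 + ((inp.nat 0 2 - 1) * (200 + 4 + 10) + 4 + 7)))
    (Halts.rset_seq <| Halts.rset_seq <| Halts.forTo (B := 200)
    (inp.nat 0 2 - 1) (fun j τ => τ.nat 6 0 = j ∧ Frame [6] [6, 7, 8, 14] σ τ ∧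
      τ.used = σ.used + j * 2 ∧
      ∀ i ≤ j, τ.real 7 i = prefixMass (inp.real 1) (tapeCauchy ω σ.used) i ∧
        τ.real 8 i = prefixMoment (inp.real 1) (σ.real 5) (tapeCauchy ω σ.used) i)
        ?_ ?_ ?_ fun τ hτ => hτ.2) (by omega) fun τ hτ => hτ
  · rintro j hj τ ⟨h1, h2, -⟩
    exact ⟨h1, by simp [NExpr.eval, h2.1 0 (by simp), hσ.1 0 (by simp)]⟩
  · refine ⟨by simp, (((Frame.refl _ _ _).setReal (by simp) _ _).setReal (by simp) _ _).setNat
      (by simp) _ _, by simp, ?_⟩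
    intro i hi
    obtain rfl : i = 0 := by omega
    simp [NExpr.eval, RExpr.eval, prefixMass, prefixMoment]
  · rintro j hj τ ⟨h1, h2, h3, h4⟩
    refine Halts.le (Halts.draw_seq <| Halts.draw_seq <| Halts.rset_seq <| Halts.rset_seq <|
      Halts.rset_seq <| Halts.rset_seq <| Halts.rset ?_) (by decide)
    have hv : ∀ (υ : State) (z : ℕ), υ.real 6 z = ω (σ.used + (j * 2 + z)) →
        (cauchyExpr (.get 6 (.const z))).eval υ = tapeCauchy ω σ.used j z := fun υ z hυ =>
      eval_cauchyExpr υ _ _ hυ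
    rw [hv _ 0 (by simp [NExpr.eval, h3])]
    rw [hv _ 1 (by simp [NExpr.eval, h3, add_assoc])]
    refine ⟨by simp [h1], ?_, by simp [h3]; ring, ?_⟩
    · refine Frame.setNat ?_ (by simp) _ _
      refine Frame.setReal ?_ (by simp) _ _
      refine Frame.setReal ?_ (by simp) _ _
      refine Frame.setReal ?_ (by simp) _ _
      refine Frame.setReal ?_ (by simp) _ _
      refine Frame.setReal ?_ (by simp) _ _
      refine Frame.setUsed (Frame.setReal ?_ (by simp) _ _) _
      exact Frame.setUsed (h2.setReal (by simp) _ _) _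
    · have ha : τ.real 1 = inp.real 1 := by rw [h2.2 1 (by simp), hσ.2 1 (by simp)]
      have hθ : τ.real 5 = σ.real 5 := h2.2 5 (by simp)
      intro i hi
      by_cases hij : i = j + 1
      · subst hij
        have h7 := h4 j le_rfl
        simp only [prefixMass, prefixMoment, Finset.sum_range_succ] at h7 ⊢
        simp [NExpr.eval, RExpr.eval, h1, ha, hθ, h7, node]
      · have h7 := h4 i (by omega)
        simp [NExpr.eval, RExpr.eval, h1, hij, h7]

/-- The sketch of a function with coefficients `α₀`, `α₁` on pieces with endpoints given by the
index tables `b` and `c`. -/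
noncomputable def pieceSum (n : ℕ) (b c : ℕ → ℕ) (α₀ α₁ P Q : ℕ → ℝ) (j : ℕ) : ℝ :=
  ∑ l ∈ Finset.range n, (α₀ (j * n + l) * (P (c (j * n + l)) - P (b (j * n + l))) +
    α₁ (j * n + l) * (Q (c (j * n + l)) - Q (b (j * n + l))))

/-- The index of the current piece. -/
abbrev pieceExpr : NExpr := .add (.mul (nvar 7) (.get 0 (.const 1))) (nvar 8)

/-- Compute the sketches of all functions from the prefix sums. -/
def sketchAll : Prog :=
  .forTo 7 (.get 0 (.const 0)) <|
  .seq (.rset 12 (.const 0) (.cast (.const 0))) <|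
  .seq (.forTo 8 (.get 0 (.const 1)) <|
    .rset 12 (.const 0) (.add (rvar 12) (.add
      (.mul (.get 2 pieceExpr) (.sub (.get 7 (.get 2 pieceExpr)) (.get 7 (.get 1 pieceExpr))))
      (.mul (.get 3 pieceExpr) (.sub (.get 8 (.get 2 pieceExpr)) (.get 8 (.get 1 pieceExpr))))))) <|
  .rset 9 (.add (.mul (.add (.mul (nvar 4) (.const 4)) (nvar 5)) (.get 0 (.const 0))) (nvar 7))
    (rvar 12)

/-- Each piece costs a bounded number of operations, whatever number of cells it covers.
Preservation of the earlier part of array 9 is recorded because the sketches of all repetitions are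
kept for the estimates. -/
theorem sketchAll_halts {ω : Tape} {inp σ : State} (hσ : HasInput inp σ) :
    Halts ω sketchAll σ (inp.nat 0 0 * (100 * inp.nat 0 1 + 100) + 20) fun τ =>
      Frame [7, 8] [9, 12] σ τ ∧ τ.used = σ.used ∧
      (∀ i < (σ.nat 4 0 * 4 + σ.nat 5 0) * inp.nat 0 0, τ.real 9 i = σ.real 9 i) ∧
      ∀ j < inp.nat 0 0, τ.real 9 ((σ.nat 4 0 * 4 + σ.nat 5 0) * inp.nat 0 0 + j) =
        pieceSum (inp.nat 0 1) (inp.nat 1) (inp.nat 2) (inp.real 2) (inp.real 3)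
          (σ.real 7) (σ.real 8) j := by
  refine Halts.mono (Halts.forTo (B := inp.nat 0 1 * (70 + 2 + 10) + 40)
    (inp.nat 0 0) (fun j τ => τ.nat 7 0 = j ∧ Frame [7, 8] [9, 12] σ τ ∧ τ.used = σ.used ∧
      (∀ i < (σ.nat 4 0 * 4 + σ.nat 5 0) * inp.nat 0 0, τ.real 9 i = σ.real 9 i) ∧
      ∀ k < j, τ.real 9 ((σ.nat 4 0 * 4 + σ.nat 5 0) * inp.nat 0 0 + k) =
        pieceSum (inp.nat 0 1) (inp.nat 1) (inp.nat 2) (inp.real 2) (inp.real 3)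
          (σ.real 7) (σ.real 8) k) ?_ ?_ ?_ fun τ hτ => hτ.2) ?_ fun τ hτ => hτ
  · rintro j hj τ ⟨h1, h2, -⟩
    exact ⟨h1, by simp [NExpr.eval, h2.1 0 (by simp), hσ.1 0 (by simp)]⟩
  · exact ⟨by simp, (Frame.refl _ _ _).setNat (by simp) _ _, by simp, by simp, by simp⟩
  · rintro j hj τ ⟨h1, h2, h3, h4, h5⟩
    have hτ : HasInput inp τ := hσ.frame h2 (by simp) (by simp)
    -- In `pieceSum` the argument `n` is both the number of terms and the row length of the tables.
    -- The partial sum over `l` pieces is therefore expressed with tables shifted by `j * n` and row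
    -- index 0.
    refine Halts.le (Halts.rset_seq <| Halts.seq (B' := 20) (Halts.forTo (B := 70) (inp.nat 0 1) (fun l υ =>
        υ.nat 8 0 = l ∧ Frame [8] [12] τ υ ∧ υ.used = σ.used ∧
        υ.real 12 0 = pieceSum l (fun i => inp.nat 1 (j * inp.nat 0 1 + i))
          (fun i => inp.nat 2 (j * inp.nat 0 1 + i)) (fun i => inp.real 2 (j * inp.nat 0 1 + i))
          (fun i => inp.real 3 (j * inp.nat 0 1 + i)) (σ.real 7) (σ.real 8) 0)
        ?_ ?_ ?_ fun τ hτ => hτ) ?_)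
      (by simp only [NExpr.cost, RExpr.cost]; omega)
    · rintro l hl υ ⟨g1, g2, -⟩
      exact ⟨g1, by simp [NExpr.eval, g2.1 0 (by simp), hτ.1 0 (by simp)]⟩
    · exact ⟨by simp, ((Frame.refl _ _ _).setReal (by simp) _ _).setNat (by simp) _ _,
        by simp [h3], by simp [NExpr.eval, RExpr.eval, pieceSum]⟩
    · rintro l hl υ ⟨g1, g2, g3, g4⟩
      refine Halts.le (Halts.rset ⟨?_, ?_, ?_, ?_⟩) (by decide)
      · simp [g1]
      · exact (g2.setReal (by simp) _ _).setNat (by simp) _ _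
      · simp [g3]
      · have e0 : υ.nat 0 = inp.nat 0 := by rw [g2.1 0 (by simp), hτ.1 0 (by simp)]
        have e1 : υ.nat 1 = inp.nat 1 := by rw [g2.1 1 (by simp), hτ.1 1 (by simp)]
        have e2 : υ.nat 2 = inp.nat 2 := by rw [g2.1 2 (by simp), hτ.1 2 (by simp)]
        have e3 : υ.real 2 = inp.real 2 := by rw [g2.2 2 (by simp), hτ.2 2 (by simp)]
        have e4 : υ.real 3 = inp.real 3 := by rw [g2.2 3 (by simp), hτ.2 3 (by simp)]
        have e5 : υ.real 7 = σ.real 7 := by rw [g2.2 7 (by simp), h2.2 7 (by simp)]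
        have e6 : υ.real 8 = σ.real 8 := by rw [g2.2 8 (by simp), h2.2 8 (by simp)]
        have e7 : υ.nat 7 0 = j := by rw [g2.1 7 (by simp), h1]
        have e8 : pieceSum (l + 1) (fun i => inp.nat 1 (j * inp.nat 0 1 + i))
          (fun i => inp.nat 2 (j * inp.nat 0 1 + i)) (fun i => inp.real 2 (j * inp.nat 0 1 + i))
          (fun i => inp.real 3 (j * inp.nat 0 1 + i)) (σ.real 7) (σ.real 8) 0 =
          pieceSum l (fun i => inp.nat 1 (j * inp.nat 0 1 + i))
          (fun i => inp.nat 2 (j * inp.nat 0 1 + i)) (fun i => inp.real 2 (j * inp.nat 0 1 + i))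
          (fun i => inp.real 3 (j * inp.nat 0 1 + i)) (σ.real 7) (σ.real 8) 0 +
          (inp.real 2 (j * inp.nat 0 1 + l) * (σ.real 7 (inp.nat 2 (j * inp.nat 0 1 + l)) -
            σ.real 7 (inp.nat 1 (j * inp.nat 0 1 + l))) +
          inp.real 3 (j * inp.nat 0 1 + l) * (σ.real 8 (inp.nat 2 (j * inp.nat 0 1 + l)) -
            σ.real 8 (inp.nat 1 (j * inp.nat 0 1 + l)))) := by
          simp [pieceSum, Finset.sum_range_succ]
        rw [e8]
        simp [NExpr.eval, RExpr.eval, g1, g4, e0, e1, e2, e3, e4, e5, e6, e7]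
    · rintro υ ⟨g1, g2, g3, g4⟩
      have e0 : υ.nat 0 = inp.nat 0 := by rw [g2.1 0 (by simp), hτ.1 0 (by simp)]
      have e4 : υ.nat 4 = σ.nat 4 := by rw [g2.1 4 (by simp), h2.1 4 (by simp)]
      have e5 : υ.nat 5 = σ.nat 5 := by rw [g2.1 5 (by simp), h2.1 5 (by simp)]
      have e7 : υ.nat 7 0 = j := by rw [g2.1 7 (by simp), h1]
      have e9 : υ.real 9 = τ.real 9 := g2.2 9 (by simp)
      refine Halts.le (Halts.rset ⟨?_, ?_, ?_, ?_, ?_⟩) (by decide)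
      · simp [e7]
      · exact ((h2.trans g2 (by simp) (by simp)).setReal (by simp) _ _).setNat (by simp) _ _
      · simp [g3]
      · intro i hi
        rw [← h4 i hi]
        simp only [NExpr.eval, RExpr.eval, setNat_real, setReal_real, e0, e4, e5, e7, e9]
        rw [if_neg (by omega)]
      · intro k hk
        simp only [NExpr.eval, RExpr.eval, setNat_real, setReal_real, e0, e4, e5, e7, e9]
        by_cases hkj : k = j
        · subst hkj
          simp [g4, pieceSum]
        · rw [if_neg (by omega), h5 k (by omega)]
  · simp only [NExpr.cost]
    nlinarith [Nat.zero_le (inp.nat 0 0 * inp.nat 0 1), Nat.zero_le (inp.nat 0 0)]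

end RealRAM

namespace RealRAM

theorem prefixMoment_congr {a θ θ' : ℕ → ℝ} {Z : ℕ → ℕ → ℝ} {i C : ℕ} (hi : i ≤ C)
    (h : ∀ k < C, θ k = θ' k) : prefixMoment a θ Z i = prefixMoment a θ' Z i :=
  Finset.sum_congr rfl fun k hk => by
    rw [h k ((Finset.mem_range.mp hk).trans_le hi)]

/-- The computed prefix sums are only known at indices up to the number of cells, so the bounds on
the index tables are needed to replace them by the exact ones. -/
theorem pieceSum_congr {n m C j : ℕ} {b c : ℕ → ℕ} {α₀ α₁ P Q P' Q' : ℕ → ℝ} (hj : j < m)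
    (hb : ∀ i < m * n, b i ≤ C) (hc : ∀ i < m * n, c i ≤ C)
    (hP : ∀ i ≤ C, P i = P' i) (hQ : ∀ i ≤ C, Q i = Q' i) :
    pieceSum n b c α₀ α₁ P Q j = pieceSum n b c α₀ α₁ P' Q' j := by
  refine Finset.sum_congr rfl fun l hl => ?_
  have hl' := Finset.mem_range.mp hl
  have : j * n + l < m * n := by nlinarith [Nat.mul_le_mul_right n (Nat.succ_le_of_lt hj)]
  rw [hP _ (hb _ this), hP _ (hc _ this), hQ _ (hb _ this), hQ _ (hc _ this)]

/-- The value of the `g`-th sketch of the `j`-th function in the `r`-th repetition. -/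
noncomputable def sketchValue (inp : State) (ω : Tape) (r g j : ℕ) : ℝ :=
  pieceSum (inp.nat 0 1) (inp.nat 1) (inp.nat 2) (inp.real 2) (inp.real 3)
    -- Row 0 of each block of five holds the node shifts, hence the `g + 1`.
    (prefixMass (inp.real 1) (tapeCauchy ω ((r * 5 + (g + 1)) * ((inp.nat 0 2 - 1) * 2))))
    (prefixMoment (inp.real 1) (fun i => ω (r * 5 * ((inp.nat 0 2 - 1) * 2) + i * 2))
      (tapeCauchy ω ((r * 5 + (g + 1)) * ((inp.nat 0 2 - 1) * 2)))) j

/-- Draw the random numbers of one repetition and compute the sketches. -/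
def sketchRound : Prog :=
  .seq drawNodes (.forTo 5 (.const 4) (.seq drawPrefix sketchAll))

theorem block_index_lt {g q m j : ℕ} (hg : g < q) (hj : j < m) : g * m + j < q * m := by
  nlinarith [Nat.mul_le_mul_right m (Nat.succ_le_of_lt hg)]

theorem sketchRound_halts {ω : Tape} {inp σ : State} (hσ : HasInput inp σ)
    (hb : ∀ i < inp.nat 0 0 * inp.nat 0 1, inp.nat 1 i ≤ inp.nat 0 2 - 1)
    (hc : ∀ i < inp.nat 0 0 * inp.nat 0 1, inp.nat 2 i ≤ inp.nat 0 2 - 1) (r : ℕ)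
    (hr : σ.nat 4 0 = r) (hu : σ.used = r * 5 * ((inp.nat 0 2 - 1) * 2)) :
    Halts ω sketchRound σ (1230 * (inp.nat 0 2 - 1) +
      4 * (inp.nat 0 0 * (100 * inp.nat 0 1 + 100)) + 400) fun τ =>
      Frame [5, 6, 7, 8] [5, 6, 7, 8, 9, 12, 14] σ τ ∧
      τ.used = (r + 1) * 5 * ((inp.nat 0 2 - 1) * 2) ∧
      (∀ i < r * 4 * inp.nat 0 0, τ.real 9 i = σ.real 9 i) ∧
      ∀ g < 4, ∀ j < inp.nat 0 0,
        τ.real 9 ((r * 4 + g) * inp.nat 0 0 + j) = sketchValue inp ω r g j := by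
  set C := inp.nat 0 2 - 1 with hC
  refine Halts.le (Halts.seq (drawNodes_halts hσ) fun σ₁ ⟨f1, u1, t1⟩ => Halts.forTo
    (B := (300 * C + 50) + (inp.nat 0 0 * (100 * inp.nat 0 1 + 100) + 20)) 4
    (fun q τ => τ.nat 5 0 = q ∧ Frame [5, 6, 7, 8] [6, 7, 8, 9, 12, 14] σ₁ τ ∧
      τ.used = (r * 5 + (q + 1)) * (C * 2) ∧
      (∀ i < r * 4 * inp.nat 0 0, τ.real 9 i = σ.real 9 i) ∧
      ∀ g < q, ∀ j < inp.nat 0 0,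
        τ.real 9 ((r * 4 + g) * inp.nat 0 0 + j) = sketchValue inp ω r g j)
    ?_ ?_ ?_ fun τ ⟨h1, h2, h3, h4, h5⟩ =>
      ⟨((Frame.refl _ _ _).trans f1 (by simp) (by simp)).trans h2 (by simp) (by simp), ?_,
        h4, h5⟩) ?_
  · rintro q hq τ ⟨h1, -⟩
    exact ⟨h1, rfl⟩
  · refine ⟨by simp, (Frame.refl _ _ _).setNat (by simp) _ _, ?_, ?_, by simp⟩
    · rw [setNat_used, u1, hu]; ring
    · intro i _
      rw [setNat_real, f1.2 9 (by simp)]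
  · rintro q hq τ ⟨h1, h2, h3, h4, h5⟩
    have hτ : HasInput inp τ := (hσ.frame f1 (by simp) (by simp)).frame h2 (by simp) (by simp)
    refine Halts.seq (drawPrefix_halts hτ) fun τ₁ ⟨g1, g2, g3⟩ => ?_
    have hτ₁ : HasInput inp τ₁ := hτ.frame g1 (by simp) (by simp)
    refine (sketchAll_halts hτ₁).mono le_rfl fun τ₂ ⟨k1, k2, k3, k4⟩ => ?_
    have n4 : τ₁.nat 4 0 = r := by
      rw [g1.1 4 (by simp), h2.1 4 (by simp), f1.1 4 (by simp), hr]
    have n5 : τ₁.nat 5 0 = q := by rw [g1.1 5 (by simp), h1]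
    rw [n4, n5] at k3 k4
    have e9 : τ₁.real 9 = τ.real 9 := g1.2 9 (by simp)
    rw [e9] at k3
    have e5 : τ.real 5 = σ₁.real 5 := h2.2 5 (by simp)
    refine ⟨?_, ?_, ?_, ?_, ?_⟩
    · simp [k1.1 5 (by simp), n5]
    · exact ((h2.trans g1 (by simp) (by simp)).trans k1 (by simp) (by simp)).setNat (by simp) _ _
    · rw [setNat_used, k2, g2, h3, ← hC]; ring
    · intro i hi
      rw [setNat_real, k3 i (by nlinarith [Nat.zero_le (q * inp.nat 0 0)]), h4 i hi]
    · intro g hg j hj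
      rw [setNat_real]
      rcases Nat.lt_succ_iff_lt_or_eq.mp hg with hg | rfl
      · rw [k3 _ (block_index_lt (by omega) hj), h5 g hg j hj]
      · rw [k4 j hj, sketchValue]
        refine pieceSum_congr hj hb hc (fun i hi => ?_) fun i hi => ?_
        · rw [(g3 i hi).1, h3]
        · rw [(g3 i hi).2, h3]
          refine prefixMoment_congr hi fun k hk => ?_
          rw [e5, t1 k hk, hu]
  · rw [h3]; ring
  · simp only [NExpr.cost]; omega

/-- Carry out all repetitions. -/
def sketchRounds : Prog := .forTo 4 (nvar 3) sketchRound

theorem sketchRounds_halts {ω : Tape} {inp σ : State} (hσ : HasInput inp σ)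
    (hb : ∀ i < inp.nat 0 0 * inp.nat 0 1, inp.nat 1 i ≤ inp.nat 0 2 - 1)
    (hc : ∀ i < inp.nat 0 0 * inp.nat 0 1, inp.nat 2 i ≤ inp.nat 0 2 - 1) (hu : σ.used = 0) :
    Halts ω sketchRounds σ (σ.nat 3 0 * (1230 * (inp.nat 0 2 - 1) +
      4 * (inp.nat 0 0 * (100 * inp.nat 0 1 + 100)) + 420) + 20) fun τ =>
      Frame [4, 5, 6, 7, 8] [5, 6, 7, 8, 9, 12, 14] σ τ ∧
      ∀ r < σ.nat 3 0, ∀ g < 4, ∀ j < inp.nat 0 0,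
        τ.real 9 ((r * 4 + g) * inp.nat 0 0 + j) = sketchValue inp ω r g j := by
  refine Halts.mono (Halts.forTo (B := 1230 * (inp.nat 0 2 - 1) +
      4 * (inp.nat 0 0 * (100 * inp.nat 0 1 + 100)) + 400) (σ.nat 3 0) (fun q τ => τ.nat 4 0 = q ∧
      Frame [4, 5, 6, 7, 8] [5, 6, 7, 8, 9, 12, 14] σ τ ∧
      τ.used = q * 5 * ((inp.nat 0 2 - 1) * 2) ∧
      ∀ r < q, ∀ g < 4, ∀ j < inp.nat 0 0,
        τ.real 9 ((r * 4 + g) * inp.nat 0 0 + j) = sketchValue inp ω r g j) ?_ ?_ ?_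
        fun τ hτ => hτ) ?_ fun τ hτ => ⟨hτ.2.1, hτ.2.2.2⟩
  · rintro q hq τ ⟨h1, h2, -⟩
    exact ⟨h1, by simp [NExpr.eval, h2.1 3 (by simp)]⟩
  · exact ⟨by simp, (Frame.refl _ _ _).setNat (by simp) _ _, by simp [hu], by simp⟩
  · rintro q hq τ ⟨h1, h2, h3, h4⟩
    refine (sketchRound_halts (hσ.frame h2 (by simp) (by simp)) hb hc q h1 h3).mono le_rfl
      fun υ ⟨k1, k2, k3, k4⟩ => ⟨?_, ?_, k2, ?_⟩
    · simp [k1.1 4 (by simp), h1]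
    · exact (h2.trans k1 (by simp) (by simp)).setNat (by simp) _ _
    · intro r hr g hg j hj
      rw [setNat_real]
      rcases Nat.lt_succ_iff_lt_or_eq.mp hr with hr | rfl
      · rw [k3 _ (block_index_lt (by omega) hj), h4 r hr g hg j hj]
      · exact k4 g hg j hj
  · simp only [NExpr.cost]
    have := Nat.mul_le_mul_left (σ.nat 3 0) (show 1230 * (inp.nat 0 2 - 1) +
      4 * (inp.nat 0 0 * (100 * inp.nat 0 1 + 100)) + 400 + (1 + 1) + 10 ≤
      1230 * (inp.nat 0 2 - 1) + 4 * (inp.nat 0 0 * (100 * inp.nat 0 1 + 100)) + 420 by omega)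
    linarith

/-! ### The program: estimates for all pairs. -/

/-- The fourth root of `|t|`. -/
noncomputable def fourthRootAbs (t : ℝ) : ℝ := Real.sqrt (Real.sqrt (Real.sqrt (t * t)))

/-- The geometric mean of the differences of the four sketches stored in the array `V`. -/
noncomputable def storedMean (m : ℕ) (V : ℕ → ℝ) (j k r : ℕ) : ℝ :=
  fourthRootAbs ((V ((r * 4 + 0) * m + j) - V ((r * 4 + 0) * m + k)) *
    (V ((r * 4 + 1) * m + j) - V ((r * 4 + 1) * m + k)) *
    (V ((r * 4 + 2) * m + j) - V ((r * 4 + 2) * m + k)) *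
    (V ((r * 4 + 3) * m + j) - V ((r * 4 + 3) * m + k)))

/-- The difference of the `g`-th sketches of the current pair of functions. -/
def diffExpr (g : ℕ) : RExpr :=
  .sub (.get 9 (.add (.mul (.add (.mul (nvar 4) (.const 4)) (.const g)) (.get 0 (.const 0)))
      (nvar 7)))
    (.get 9 (.add (.mul (.add (.mul (nvar 4) (.const 4)) (.const g)) (.get 0 (.const 0)))
      (nvar 9)))

/-- The product of the differences of the four sketches of the current pair of functions. -/
def prodExpr : RExpr :=
  .mul (.mul (.mul (diffExpr 0) (diffExpr 1)) (diffExpr 2)) (diffExpr 3)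

/-- The geometric mean of the current pair of functions. -/
def meanExpr : RExpr := .sqrt (.sqrt (.sqrt (.mul prodExpr prodExpr)))

theorem eval_meanExpr (σ : State) : meanExpr.eval σ =
    storedMean (σ.nat 0 0) (σ.real 9) (σ.nat 7 0) (σ.nat 9 0) (σ.nat 4 0) := rfl

/-- Compute the estimate for the current pair of functions. -/
def estimatePair : Prog :=
  .seq (.rset 10 (.const 0) (.cast (.const 0))) <|
  .seq (.forTo 4 (nvar 3) (.rset 10 (.const 0) (.add (rvar 10) (.log meanExpr)))) <|
  .seq (.rset 11 (.const 0) (.div (.mul (.cast (.const 6144))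
    (.exp (.div (rvar 10) (.cast (nvar 3))))) (.get 0 (.const 0)))) <|
  .seq (.rset 12 (.const 0) (.cast (.const 0))) <|
  .seq (.forTo 4 (nvar 3) (.seq (.rset 13 (.const 0) meanExpr)
    (.cond (.rlt (rvar 13) (rvar 11)) (.rset 12 (.const 0) (.add (rvar 12) (rvar 13)))
      (.rset 12 (.const 0) (.add (rvar 12) (rvar 11)))))) <|
  .rset 4 (.add (.mul (nvar 7) (.get 0 (.const 0))) (nvar 9))
    (.mul (.div (rvar 12) (.cast (nvar 3))) (.div (.add (.cast (.const 3)) (.mul (.cast (.const 2))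
      (.sqrt (.cast (.const 2))))) (.cast (.const 8))))

theorem estimatePair_halts {ω : Tape} {inp σ : State} (hσ : HasInput inp σ) :
    Halts ω estimatePair σ (σ.nat 3 0 * 600 + 200) fun τ =>
      Frame [4] [4, 10, 11, 12, 13] σ τ ∧
      ∀ i, τ.real 4 i = if i = σ.nat 7 0 * inp.nat 0 0 + σ.nat 9 0 then
        truncatedMean (σ.nat 3 0) (inp.real 0 0)
          (storedMean (inp.nat 0 0) (σ.real 9) (σ.nat 7 0) (σ.nat 9 0)) else σ.real 4 i := by
  set N := σ.nat 3 0 with hN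
  set y := storedMean (inp.nat 0 0) (σ.real 9) (σ.nat 7 0) (σ.nat 9 0) with hy
  set L := ∑ r ∈ Finset.range N, Real.log (y r) with hL
  -- The geometric means are recomputed in both passes rather than stored; they depend only on
  -- arrays that `estimatePair` leaves unchanged, apart from the counter 4.
  have hmean : ∀ τ Y r, (∀ A ∈ Y, 9 < A) → Frame [4] Y σ τ → τ.nat 4 0 = r →
      meanExpr.eval τ = y r := by
    intro τ Y r hY hf h4
    rw [eval_meanExpr, hf.1 0 (by simp), hf.1 7 (by simp), hf.1 9 (by simp),
      hf.2 9 fun h => absurd (hY 9 h) (by omega), h4, hσ.1 0 (by simp)]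
  refine Halts.le (Halts.rset_seq <| Halts.seq (Halts.forTo (B := 240) N
    (fun r τ => τ.nat 4 0 = r ∧ Frame [4] [10] σ τ ∧
      τ.real 10 0 = ∑ r ∈ Finset.range r, Real.log (y r)) ?_ ?_ ?_ fun τ hτ => hτ)
    fun τ ⟨h1, h2, h3⟩ => Halts.rset_seq <| Halts.rset_seq <|
      Halts.seq (Halts.forTo (B := 280) N
    (fun r υ => υ.nat 4 0 = r ∧ Frame [4] [10, 11, 12, 13] σ υ ∧
      υ.real 11 0 = 6144 * Real.exp (L / N) / inp.real 0 0 ∧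
      υ.real 12 0 = ∑ r ∈ Finset.range r, min (y r) (6144 * Real.exp (L / N) / inp.real 0 0))
      ?_ ?_ ?_ fun τ hτ => hτ) fun υ ⟨k1, k2, k3, k4⟩ => Halts.rset ⟨?_, ?_⟩) ?_
  · rintro r hr τ ⟨h1, h2, -⟩
    exact ⟨h1, by simp [NExpr.eval, h2.1 3 (by simp), hN]⟩
  · exact ⟨by simp, ((Frame.refl _ _ _).setReal (by simp) _ _).setNat (by simp) _ _,
      by simp [NExpr.eval, RExpr.eval]⟩
  · rintro r hr τ ⟨h1, h2, h3⟩
    refine Halts.le (Halts.rset ⟨by simp [h1], (h2.setReal (by simp) _ _).setNat (by simp) _ _, ?_⟩)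
      (by decide)
    rw [Finset.sum_range_succ, ← h3, ← hmean τ _ r (by simp) h2 h1]
    simp [NExpr.eval, RExpr.eval]
  · rintro r hr τ ⟨h1, h2, -⟩
    exact ⟨h1, by simp [NExpr.eval, h2.1 3 (by simp), hN]⟩
  · have hf : Frame [4] [10, 11, 12, 13] σ τ :=
      (Frame.refl _ _ _).trans h2 (by simp) (by simp)
    refine ⟨by simp, ((hf.setReal (by simp) _ _).setReal (by simp) _ _).setNat (by simp) _ _,
      ?_, ?_⟩
    · simp [NExpr.eval, RExpr.eval, h3, h2.1 3 (by simp), h2.2 0 (by simp), hσ.2 0 (by simp), hL, hN]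
    · simp [NExpr.eval, RExpr.eval]
  · rintro r hr υ ⟨g1, g2, g3, g4⟩
    have hm := hmean υ _ r (by simp) g2 g1
    -- The branch implements the minimum with the truncation level.
    refine Halts.le (Halts.rset_seq <| Halts.cond (B := 10)
      (fun ht => Halts.le (Halts.rset ⟨by simp [g1], ?_, ?_, ?_⟩) (by decide))
      (fun ht => Halts.le (Halts.rset ⟨by simp [g1], ?_, ?_, ?_⟩) (by decide))) (by decide)
    · exact ((g2.setReal (by simp) _ _).setReal (by simp) _ _).setNat (by simp) _ _
    · simp [g3]
    · have ht' : y r < 6144 * Real.exp (L / N) / inp.real 0 0 := by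
        simpa [BExpr.eval, NExpr.eval, RExpr.eval, hm, g3] using ht
      rw [Finset.sum_range_succ, min_eq_left ht'.le]
      simp [NExpr.eval, RExpr.eval, hm, g4]
    · exact ((g2.setReal (by simp) _ _).setReal (by simp) _ _).setNat (by simp) _ _
    · simp [g3]
    · have ht' : 6144 * Real.exp (L / N) / inp.real 0 0 ≤ y r := by
        simpa [BExpr.eval, NExpr.eval, RExpr.eval, hm, g3] using ht
      rw [Finset.sum_range_succ, min_eq_right ht']
      simp [NExpr.eval, RExpr.eval, g3, g4]
  · exact ((Frame.refl _ _ _).trans k2 (by simp) (by simp)).setReal (by simp) _ _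
  · intro i
    have e0 : υ.nat 0 = inp.nat 0 := by rw [k2.1 0 (by simp), hσ.1 0 (by simp)]
    simp [NExpr.eval, RExpr.eval, e0, k2.1 7 (by simp), k2.1 9 (by simp), k2.1 3 (by simp),
      k2.2 4 (by simp), k4, truncatedMean, hL, hN]
  · simp only [NExpr.cost, RExpr.cost]; omega

/-- Compute the estimates for all pairs of functions. -/
def estimateAll : Prog :=
  .forTo 7 (.get 0 (.const 0)) (.forTo 9 (.get 0 (.const 0)) estimatePair)

theorem estimateAll_halts {ω : Tape} {inp σ : State} (hσ : HasInput inp σ) :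
    Halts ω estimateAll σ (inp.nat 0 0 * (inp.nat 0 0 * (σ.nat 3 0 * 600 + 220) + 30) + 20) fun τ =>
      ∀ j < inp.nat 0 0, ∀ k < inp.nat 0 0, τ.real 4 (j * inp.nat 0 0 + k) =
        truncatedMean (σ.nat 3 0) (inp.real 0 0) (storedMean (inp.nat 0 0) (σ.real 9) j k) := by
  set m := inp.nat 0 0 with hm
  set N := σ.nat 3 0 with hN
  refine Halts.mono (Halts.forTo (B := m * (N * 600 + 212) + 9) m (fun j τ => τ.nat 7 0 = j ∧
      Frame [4, 7, 9] [4, 10, 11, 12, 13] σ τ ∧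
      ∀ i < j, ∀ k < m, τ.real 4 (i * m + k) =
        truncatedMean N (inp.real 0 0) (storedMean m (σ.real 9) i k)) ?_ ?_ ?_
        fun τ hτ => hτ) ?_ fun τ hτ => hτ.2.2
  · rintro q hq τ ⟨h1, h2, -⟩
    exact ⟨h1, by simp [NExpr.eval, h2.1 0 (by simp), hσ.1 0 (by simp), hm]⟩
  · exact ⟨by simp, (Frame.refl _ _ _).setNat (by simp) _ _, by simp⟩
  · rintro j hj τ ⟨h1, h2, h3⟩
    refine Halts.le (Halts.forTo (B := N * 600 + 200) m (fun k υ => υ.nat 9 0 = k ∧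
      Frame [4, 9] [4, 10, 11, 12, 13] τ υ ∧ (∀ i < j * m, υ.real 4 i = τ.real 4 i) ∧
      ∀ l < k, υ.real 4 (j * m + l) =
        truncatedMean N (inp.real 0 0) (storedMean m (σ.real 9) j l)) ?_ ?_ ?_
        fun υ ⟨k1, k2, k3, k4⟩ => ⟨?_, ?_, ?_⟩) ?_
    · rintro q hq υ ⟨g1, g2, -⟩
      exact ⟨g1, by simp [NExpr.eval, g2.1 0 (by simp), h2.1 0 (by simp), hσ.1 0 (by simp), hm]⟩
    · exact ⟨by simp, (Frame.refl _ _ _).setNat (by simp) _ _, by simp, by simp⟩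
    · rintro k hk υ ⟨g1, g2, g3, g4⟩
      have hf : Frame [4, 7, 9] [4, 10, 11, 12, 13] σ υ := h2.trans g2 (by simp) (by simp)
      have hυ : HasInput inp υ := hσ.frame hf (by simp) (by simp)
      have e3 : υ.nat 3 0 = N := by rw [hf.1 3 (by simp)]
      have e7 : υ.nat 7 0 = j := by rw [g2.1 7 (by simp), h1]
      have e9 : υ.real 9 = σ.real 9 := hf.2 9 (by simp)
      have hp := estimatePair_halts (ω := ω) hυ
      rw [e3, e7, e9, g1] at hp
      refine hp.mono le_rfl fun υ' ⟨k1, k2⟩ => ⟨?_, ?_, ?_, ?_⟩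
      · simp [k1.1 9 (by simp), g1]
      · exact (g2.trans k1 (by simp) (by simp)).setNat (by simp) _ _
      · intro i hi
        rw [setNat_real, k2, if_neg (by rw [← hm]; omega), g3 i hi]
      · intro l hl
        rw [setNat_real, k2]
        rcases Nat.lt_succ_iff_lt_or_eq.mp hl with hl | rfl
        · rw [if_neg (by rw [← hm]; omega), g4 l hl]
        · rw [if_pos rfl]
    · simp [k2.1 7 (by simp), h1]
    · exact (h2.trans k2 (by simp) (by simp)).setNat (by simp) _ _
    · intro i hi k hk
      rw [setNat_real]
      rcases Nat.lt_succ_iff_lt_or_eq.mp hi with hi | rfl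
      · rw [k3 _ (block_index_lt hi hk), h3 i hi k hk]
      · exact k4 k hk
    · simp only [NExpr.cost]
      have : m * (N * 600 + 200 + (1 + 1) + 10) = m * (N * 600 + 212) := by ring
      omega
  · simp only [NExpr.cost]
    have := Nat.mul_le_mul_left m (show m * (N * 600 + 212) + 9 + (1 + 1) + 10 ≤
      m * (N * 600 + 220) + 30 by nlinarith)
    linarith

end RealRAM

/-! ### The whole program and its identification with the probabilistic estimator. -/

namespace RealRAM

/-- The number of repetitions. -/
noncomputable def roundCount (m : ℕ) (ε δ : ℝ) : ℕ := ⌈2359296 * Real.log (m / δ) / (ε * ε)⌉₊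

/-- Compute the number of repetitions. -/
def countRounds : Prog :=
  .seq (.nset 3 (.const 0) (.const 0)) <|
  .loop (.rlt (.mul (.cast (nvar 3)) (.mul (rvar 0) (rvar 0)))
    (.mul (.cast (.const 2359296)) (.log (.div (.cast (.get 0 (.const 0))) (.get 0 (.const 1))))))
    (.nset 3 (.const 0) (.add (nvar 3) (.const 1)))

/-- Without a rounding operation the ceiling is found by counting up: `j < ⌈x⌉₊` is equivalent to `j
< x`, tested after multiplication by `ε²`. The cost is linear in the number of repetitions. -/
theorem countRounds_halts {ω : Tape} {inp : State} (hε : 0 < inp.real 0 0) :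
    Halts ω countRounds inp (roundCount (inp.nat 0 0) (inp.real 0 0) (inp.real 0 1) * 40 + 40)
      fun τ => Frame [3] [] inp τ ∧ τ.used = inp.used ∧
        τ.nat 3 0 = roundCount (inp.nat 0 0) (inp.real 0 0) (inp.real 0 1) := by
  refine Halts.mono (Halts.nset_seq (Halts.loop (B := 10)
    (roundCount (inp.nat 0 0) (inp.real 0 0) (inp.real 0 1))
    (fun j τ => Frame [3] [] inp τ ∧ τ.used = inp.used ∧ τ.nat 3 0 = j) ?_ ?_ ?_)) ?_
    fun τ hτ => hτ
  · rintro j hj τ ⟨h1, h2, h3⟩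
    rw [roundCount, Nat.lt_ceil, lt_div_iff₀ (by positivity)]
    simp [BExpr.eval, RExpr.eval, NExpr.eval, h3, h1.1 0 (by simp), h1.2 0 (by simp)]
  · rintro j hj τ ⟨h1, h2, h3⟩
    exact Halts.le (Halts.nset ⟨h1.setNat (by simp) _ _, h2, by simp [NExpr.eval, h3]⟩) (by decide)
  · exact ⟨(Frame.refl _ _ _).setNat (by simp) _ _, rfl, by simp [NExpr.eval]⟩
  · simp only [NExpr.cost, BExpr.cost, RExpr.cost]; omega

/-- The program that approximates all pairwise `L₁`-distances. -/
def distanceProg : Prog := .seq countRounds (.seq sketchRounds estimateAll)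

/-- The geometric mean of the differences of four sketches. -/
noncomputable def sketchMean (inp : State) (ω : Tape) (j k r : ℕ) : ℝ :=
  fourthRootAbs (∏ g : Fin 4, (sketchValue inp ω r g j - sketchValue inp ω r g k))

theorem distanceProg_halts {ω : Tape} {inp : State} (hε : 0 < inp.real 0 0) (hu : inp.used = 0)
    (hb : ∀ i < inp.nat 0 0 * inp.nat 0 1, inp.nat 1 i ≤ inp.nat 0 2 - 1)
    (hc : ∀ i < inp.nat 0 0 * inp.nat 0 1, inp.nat 2 i ≤ inp.nat 0 2 - 1) {m n C N : ℕ}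
    (hm : inp.nat 0 0 = m) (hn : inp.nat 0 1 = n) (hC : inp.nat 0 2 - 1 = C)
    (hN : roundCount (inp.nat 0 0) (inp.real 0 0) (inp.real 0 1) = N) :
    Halts ω distanceProg inp ((N * 40 + 40) + ((N * (1230 * C + 4 * (m * (100 * n + 100)) + 420) +
      20) + (m * (m * (N * 600 + 220) + 30) + 20))) fun τ =>
      ∀ j < m, ∀ k < m, τ.real 4 (j * m + k) =
        truncatedMean N (inp.real 0 0) (sketchMean inp ω j k) := by
  subst hm hn hC hN
  have hi : HasInput inp inp := ⟨fun _ _ => rfl, fun _ _ => rfl⟩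
  refine Halts.seq (countRounds_halts hε) fun τ ⟨h1, h2, h3⟩ => ?_
  have hτ := hi.frame h1 (by simp) (by simp)
  have hs := sketchRounds_halts (ω := ω) hτ hb hc (h2.trans hu)
  rw [h3] at hs
  refine Halts.seq hs fun υ ⟨g1, g2⟩ => ?_
  have he := estimateAll_halts (ω := ω) (hτ.frame g1 (by simp) (by simp))
  rw [g1.1 3 (by simp), h3] at he
  refine he.mono le_rfl fun ρ hρ j hj k hk => ?_
  rw [hρ j hj k hk]
  refine truncatedMean_congr _ fun r hr => ?_
  rw [storedMean, sketchMean, Fin.prod_univ_four, g2 r hr 0 (by simp) j hj, g2 r hr 0 (by simp) k hk,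
    g2 r hr 1 (by simp) j hj, g2 r hr 1 (by simp) k hk, g2 r hr 2 (by simp) j hj,
    g2 r hr 2 (by simp) k hk, g2 r hr 3 (by simp) j hj, g2 r hr 3 (by simp) k hk]
  rfl

theorem fourthRootAbs_eq (t : ℝ) : fourthRootAbs t = |t| ^ (1 / 4 : ℝ) := by
  rw [fourthRootAbs, Real.sqrt_mul_self_eq_abs, Real.sqrt_eq_rpow, Real.sqrt_eq_rpow,
    ← Real.rpow_mul (abs_nonneg t)]
  norm_num

theorem sum_range_sub_sum_range {f : ℕ → ℝ} {b c C : ℕ} (hbc : b ≤ c) (hc : c ≤ C) :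
    ∑ i ∈ Finset.range c, f i - ∑ i ∈ Finset.range b, f i =
      ∑ i ∈ Finset.range C, if b ≤ i ∧ i < c then f i else 0 := by
  rw [← Finset.sum_Ico_eq_sub f hbc, ← Finset.sum_filter]
  congr 1
  ext i
  simp
  omega

/-- The coefficient of the `j`-th function on the `i`-th cell. -/
def pieceCoef (n : ℕ) (b c : ℕ → ℕ) (α : ℕ → ℝ) (j i : ℕ) : ℝ :=
  ∑ l ∈ Finset.range n, if b (j * n + l) ≤ i ∧ i < c (j * n + l) then α (j * n + l) else 0

/-- Differences of prefix sums are sums over the cells of a piece. Exchanging the sums over pieces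
and cells shows the sketch as a linear functional of the cellwise coefficients. -/
theorem pieceSum_prefix {n C j : ℕ} {b c : ℕ → ℕ} {α₀ α₁ a θ : ℕ → ℝ} {Z : ℕ → ℕ → ℝ}
    (hbc : ∀ l < n, b (j * n + l) ≤ c (j * n + l)) (hc : ∀ l < n, c (j * n + l) ≤ C) :
    pieceSum n b c α₀ α₁ (prefixMass a Z) (prefixMoment a θ Z) j =
      ∑ i ∈ Finset.range C, ∑ z : Fin 2, (a (i + 1) - a i) / 2 *
        (pieceCoef n b c α₀ j i + pieceCoef n b c α₁ j i * node (a i) (a (i + 1)) (θ i) ((z : ℕ) : ℝ)) *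
          Z i z := by
  have h : ∀ l ∈ Finset.range n, α₀ (j * n + l) * (prefixMass a Z (c (j * n + l)) -
      prefixMass a Z (b (j * n + l))) + α₁ (j * n + l) * (prefixMoment a θ Z (c (j * n + l)) -
      prefixMoment a θ Z (b (j * n + l))) = ∑ i ∈ Finset.range C,
      ∑ z : Fin 2, (a (i + 1) - a i) / 2 *
        ((if b (j * n + l) ≤ i ∧ i < c (j * n + l) then α₀ (j * n + l) else 0) +
        (if b (j * n + l) ≤ i ∧ i < c (j * n + l) then α₁ (j * n + l) else 0) *
          node (a i) (a (i + 1)) (θ i) ((z : ℕ) : ℝ)) * Z i z := by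
    intro l hl
    have hl' := Finset.mem_range.mp hl
    rw [prefixMass, prefixMass, prefixMoment, prefixMoment,
      sum_range_sub_sum_range (hbc l hl') (hc l hl'), sum_range_sub_sum_range (hbc l hl') (hc l hl'),
      Finset.mul_sum, Finset.mul_sum, ← Finset.sum_add_distrib]
    refine Finset.sum_congr rfl fun i _ => ?_
    rw [Fin.sum_univ_two]
    split_ifs
    · simp; ring
    · simp
  rw [pieceSum, Finset.sum_congr rfl h, Finset.sum_comm]
  refine Finset.sum_congr rfl fun i _ => ?_
  rw [Finset.sum_comm]
  refine Finset.sum_congr rfl fun z _ => ?_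
  rw [← Finset.sum_mul, ← Finset.mul_sum, Finset.sum_add_distrib, ← Finset.sum_mul]
  rfl

/-- By linearity the difference of two sketches is the sketch of the difference, so the same random
numbers serve every pair. Independence between pairs is not needed for the union bound. -/
theorem sketchMean_eq_blockMean {inp : State} {ω : Tape} {m n C j k r : ℕ} (hm : inp.nat 0 0 = m)
    (hn : inp.nat 0 1 = n) (hC : inp.nat 0 2 - 1 = C)
    (hbc : ∀ i < m * n, inp.nat 1 i ≤ inp.nat 2 i) (hc : ∀ i < m * n, inp.nat 2 i ≤ C)
    (hj : j < m) (hk : k < m) :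
    sketchMean inp ω j k r = blockMean (inp.real 1)
      (fun i => pieceCoef n (inp.nat 1) (inp.nat 2) (inp.real 2) j i -
        pieceCoef n (inp.nat 1) (inp.nat 2) (inp.real 2) k i)
      (fun i => pieceCoef n (inp.nat 1) (inp.nat 2) (inp.real 3) j i -
        pieceCoef n (inp.nat 1) (inp.nat 2) (inp.real 3) k i) (tapeBlock C ω r) := by
  subst hm hn hC
  have hidx : ∀ j < inp.nat 0 0, ∀ l < inp.nat 0 1,
      j * inp.nat 0 1 + l < inp.nat 0 0 * inp.nat 0 1 := fun j hj l hl =>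
    block_index_lt hj hl
  rw [sketchMean, fourthRootAbs_eq, Finset.abs_prod, blockMean]
  congr 1
  refine Finset.prod_congr rfl fun g _ => ?_
  congr 1
  rw [sketchValue, sketchValue, pieceSum_prefix (fun l hl => hbc _ (hidx j hj l hl))
      (fun l hl => hc _ (hidx j hj l hl)), pieceSum_prefix (fun l hl => hbc _ (hidx k hk l hl))
      (fun l hl => hc _ (hidx k hk l hl)), ← Finset.sum_sub_distrib, cauchySketch,
    Fintype.sum_prod_type, ← Fin.sum_univ_eq_sum_range (fun i => _ - _)]
  refine Finset.sum_congr rfl fun i _ => ?_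
  rw [← Finset.sum_sub_distrib]
  refine Finset.sum_congr rfl fun z _ => ?_
  have h1 : tapeBlock (inp.nat 0 2 - 1) ω r 0 (i, 0) =
      ω (r * 5 * ((inp.nat 0 2 - 1) * 2) + i * 2) := by simp [tapeBlock]
  have h2 : cauchyQuantile (tapeBlock (inp.nat 0 2 - 1) ω r g.succ (i, z)) =
      tapeCauchy ω ((r * 5 + (g + 1)) * ((inp.nat 0 2 - 1) * 2)) i z := by
    simp [tapeBlock, tapeCauchy]
  rw [h2, cellCoef, h1]
  ring

end RealRAM

/-! ### The distance of two densities as a sum over cells. -/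

theorem indicator_Ico_eq_sum {a : ℕ → ℝ} {C : ℕ} (ha : ∀ i < C, a i ≤ a (i + 1)) (h : ℝ → ℝ)
    (x : ℝ) {b c : ℕ} (hbc : b ≤ c) (hc : c ≤ C) :
    (Set.Ico (a b) (a c)).indicator h x = ∑ i ∈ Finset.range C,
      if b ≤ i ∧ i < c then (Set.Ico (a i) (a (i + 1))).indicator h x else 0 := by
  rw [← Finset.sum_filter]
  have : (Finset.range C).filter (fun i => b ≤ i ∧ i < c) = Finset.Ico b c := by
    ext i; simp; omega
  rw [this]
  induction c, hbc using Nat.le_induction with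
  | base => simp
  | succ c hbc ih =>
    have hle : a b ≤ a c := by
      clear ih this
      induction c, hbc using Nat.le_induction with
      | base => exact le_rfl
      | succ k hk ihk => exact (ihk (by omega)).trans (ha k (by omega))
    have hle' := ha c (by omega)
    rw [Finset.sum_Ico_succ_top hbc, ← ih (by omega) (by ext i; simp; omega),
      ← Set.Ico_union_Ico_eq_Ico hle hle',
      Set.indicator_union_of_disjoint (Set.Ico_disjoint_Ico_same)]

/-- The half-open cells are disjoint, even when some are empty, so at most one term is nonzero at
each point. -/
theorem abs_sum_indicator_Ico {a : ℕ → ℝ} {C : ℕ} (ha : ∀ i < C, a i ≤ a (i + 1))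
    (g : ℕ → ℝ → ℝ) (x : ℝ) :
    |∑ i ∈ Finset.range C, (Set.Ico (a i) (a (i + 1))).indicator (g i) x| =
      ∑ i ∈ Finset.range C, (Set.Ico (a i) (a (i + 1))).indicator (fun y => |g i y|) x := by
  by_cases hx : ∃ i ∈ Finset.range C, x ∈ Set.Ico (a i) (a (i + 1))
  · obtain ⟨i, hi, hxi⟩ := hx
    have hmono : ∀ k l, k ≤ l → l ≤ C → a k ≤ a l := by
      intro k l hkl
      induction l, hkl using Nat.le_induction with
      | base => exact fun _ => le_rfl
      | succ l _ ih => exact fun hl => (ih (by omega)).trans (ha l (by omega))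
    have hne : ∀ k ∈ Finset.range C, k ≠ i → x ∉ Set.Ico (a k) (a (k + 1)) := by
      intro k hk hki hxk
      rw [Finset.mem_range] at hi hk
      rcases lt_or_gt_of_ne hki with h | h
      · exact absurd (hmono (k + 1) i h (by omega)) (not_le.mpr (hxi.1.trans_lt hxk.2))
      · exact absurd (hmono (i + 1) k h (by omega)) (not_le.mpr (hxk.1.trans_lt hxi.2))
    rw [Finset.sum_eq_single_of_mem i hi fun k hk hki => Set.indicator_of_notMem (hne k hk hki) _,
      Finset.sum_eq_single_of_mem i hi fun k hk hki => Set.indicator_of_notMem (hne k hk hki) _,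
      Set.indicator_of_mem hxi, Set.indicator_of_mem hxi]
  · push Not at hx
    rw [Finset.sum_eq_zero fun i hi => Set.indicator_of_notMem (hx i hi) _,
      Finset.sum_eq_zero fun i hi => Set.indicator_of_notMem (hx i hi) _, abs_zero]

theorem integral_abs_sum_indicator {a p q : ℕ → ℝ} {C : ℕ} (ha : ∀ i < C, a i ≤ a (i + 1)) :
    ∫ x, |∑ i ∈ Finset.range C, (Set.Ico (a i) (a (i + 1))).indicator
      (fun y => p i + q i * y) x| = cellNorm a p q C := by
  simp_rw [abs_sum_indicator_Ico ha]
  rw [integral_finsetSum]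
  · refine Finset.sum_congr rfl fun i hi => ?_
    rw [integral_indicator measurableSet_Ico, integral_Ico_eq_integral_Ioc,
      intervalIntegral.integral_of_le (ha i (Finset.mem_range.mp hi))]
  · intro i _
    rw [integrable_indicator_iff measurableSet_Ico]
    exact (Continuous.integrableOn_Icc (by fun_prop)).mono_set Set.Ico_subset_Icc_self

namespace PiecewiseLinearDensities

variable {m n s : ℕ} (F : PiecewiseLinearDensities m n s)

theorem flatten_apply {R : Type*} [Zero R] (u : Fin m → Fin n → R) (j : Fin m) (l : Fin n) :
    flatten u (j * n + l) = u j l := by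
  have h : (⟨(j : ℕ) * n + l, RealRAM.block_index_lt j.2 l.2⟩ : Fin (m * n)) =
      finProdFinEquiv (j, l) := by
    ext; simp [finProdFinEquiv_apply_val]; ring
  rw [flatten, dif_pos (RealRAM.block_index_lt j.2 l.2), h, Equiv.symm_apply_apply]

theorem exists_flatten_eq {R : Type*} [Zero R] (u v : Fin m → Fin n → R) {i : ℕ} (hi : i < m * n) :
    ∃ j l, flatten u i = u j l ∧ flatten v i = v j l :=
  ⟨_, _, dif_pos hi, dif_pos hi⟩

variable (ε δ : ℝ)

/-- The coefficients of the difference of two functions on the cells. -/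
noncomputable def diffCoef (α : ℕ → ℝ) (j k : Fin m) (i : ℕ) : ℝ :=
  RealRAM.pieceCoef n ((F.input ε δ).nat 1) ((F.input ε δ).nat 2) α j i -
    RealRAM.pieceCoef n ((F.input ε δ).nat 1) ((F.input ε δ).nat 2) α k i

theorem input_endpoint (i : Fin s) : (F.input ε δ).real 1 i = F.a i := by
  simp [input]

theorem input_mono : ∀ i < s - 1, (F.input ε δ).real 1 i ≤ (F.input ε δ).real 1 (i + 1) := by
  intro i hi
  have h1 := F.input_endpoint ε δ ⟨i, by omega⟩
  have h2 := F.input_endpoint ε δ ⟨i + 1, by omega⟩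
  simp only at h1 h2
  rw [h1, h2]
  exact F.a_mono (by simp)

/-- Every piece is the disjoint union of its cells; collecting the pieces that cover a cell gives
the coefficients there. -/
theorem density_eq (j : Fin m) (x : ℝ) : F.density j x = ∑ i ∈ Finset.range (s - 1),
    (Set.Ico ((F.input ε δ).real 1 i) ((F.input ε δ).real 1 (i + 1))).indicator (fun y =>
      RealRAM.pieceCoef n ((F.input ε δ).nat 1) ((F.input ε δ).nat 2) ((F.input ε δ).real 2) j i +
      RealRAM.pieceCoef n ((F.input ε δ).nat 1) ((F.input ε δ).nat 2) ((F.input ε δ).real 3) j i *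
        y) x := by
  have h : ∀ l : Fin n, (Set.Ico (F.a (F.b j l)) (F.a (F.c j l))).indicator
      (fun y => F.α₀ j l + F.α₁ j l * y) x = ∑ i ∈ Finset.range (s - 1),
      if (F.b j l : ℕ) ≤ i ∧ i < (F.c j l : ℕ) then
        (Set.Ico ((F.input ε δ).real 1 i) ((F.input ε δ).real 1 (i + 1))).indicator
          (fun y => F.α₀ j l + F.α₁ j l * y) x else 0 := by
    intro l
    rw [← F.input_endpoint ε δ, ← F.input_endpoint ε δ]
    exact indicator_Ico_eq_sum (F.input_mono ε δ) _ x (F.b_lt_c j l).le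
      (by have := (F.c j l).2; omega)
  rw [density, Finset.sum_congr rfl fun l _ => h l, Finset.sum_comm]
  refine Finset.sum_congr rfl fun i _ => ?_
  have e0 : ∀ α : Fin m → Fin n → ℝ, RealRAM.pieceCoef n ((F.input ε δ).nat 1)
      ((F.input ε δ).nat 2) (flatten α) j i =
      ∑ l : Fin n, if (F.b j l : ℕ) ≤ i ∧ i < (F.c j l : ℕ) then α j l else 0 := by
    intro α
    rw [RealRAM.pieceCoef, ← Fin.sum_univ_eq_sum_range (fun l =>
      if (F.input ε δ).nat 1 (j * n + l) ≤ i ∧ i < (F.input ε δ).nat 2 (j * n + l) then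
        flatten α (j * n + l) else 0)]
    simp [input, flatten_apply]
  have e2 : (F.input ε δ).real 2 = flatten F.α₀ := rfl
  have e3 : (F.input ε δ).real 3 = flatten F.α₁ := rfl
  rw [e2, e3, e0, e0]
  by_cases hx : x ∈ Set.Ico ((F.input ε δ).real 1 i) ((F.input ε δ).real 1 (i + 1))
  · simp only [Set.indicator_of_mem hx, Finset.sum_mul, ← Finset.sum_add_distrib]
    refine Finset.sum_congr rfl fun l _ => ?_
    split_ifs <;> simp
  · simp [Set.indicator_of_notMem hx]

theorem dist_eq_cellNorm (j k : Fin m) : F.dist j k = cellNorm ((F.input ε δ).real 1)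
    (F.diffCoef ε δ ((F.input ε δ).real 2) j k) (F.diffCoef ε δ ((F.input ε δ).real 3) j k)
    (s - 1) := by
  rw [dist, ← integral_abs_sum_indicator (F.input_mono ε δ)]
  refine integral_congr_ae (ae_of_all _ fun x => ?_)
  simp only
  rw [F.density_eq ε δ, F.density_eq ε δ, ← Finset.sum_sub_distrib]
  congr 1
  refine Finset.sum_congr rfl fun i _ => ?_
  by_cases hx : x ∈ Set.Ico ((F.input ε δ).real 1 i) ((F.input ε δ).real 1 (i + 1))
  · simp only [Set.indicator_of_mem hx, diffCoef]
    ring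
  · simp [Set.indicator_of_notMem hx]

end PiecewiseLinearDensities

/-! ### Failure probability, cost and conclusion. -/

/-- The quadrature is at most four times the norm, so norm zero forces every weighted node value,
and hence every sketch, to vanish for all random numbers. -/
theorem blockMean_eq_zero {C : ℕ} {x p q : ℕ → ℝ} (hx : ∀ i < C, x i ≤ x (i + 1))
    (hd : cellNorm x p q C = 0) (B : Block C) : blockMean x p q B = 0 := by
  have h := rowScale_le x p q hx (B 0)
  rw [hd, mul_zero] at h
  have h2 : ∀ k, cellCoef x p q (B 0) k = 0 := by
    intro k
    have := (Finset.single_le_sum (f := fun k => |cellCoef x p q (B 0) k|)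
      (fun _ _ => abs_nonneg _) (Finset.mem_univ k)).trans h
    exact abs_nonpos_iff.mp this
  simp [blockMean, cauchySketch, h2]

/-- The truncation level is an exponential over `ε`, hence positive even though the logarithms of 0
take a default value. -/
theorem truncatedMean_zero (N : ℕ) {ε : ℝ} (hε : 0 < ε) : truncatedMean N ε (fun _ => 0) = 0 := by
  have : ∀ z : ℝ, min 0 (6144 * Real.exp z / ε) = 0 := fun z => min_eq_left (by positivity)
  simp only [truncatedMean, this, Finset.sum_const_zero, zero_div, zero_mul]

-- Positive distances are handled by concentration; for distance zero the estimate is always zero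
-- and the bad event is empty.
open RealRAM in
theorem tapeLaw_not_isApprox_le {m n s : ℕ} (F : PiecewiseLinearDensities m n s) {ε δ : ℝ}
    (h0 : 0 < ε) (h1 : ε ≤ 1) {N : ℕ} (hN : 0 < N) (j k : Fin m) :
    tapeLaw {ω | ¬ ((1 - ε) * truncatedMean N ε (sketchMean (F.input ε δ) ω j k) ≤ F.dist j k ∧
      F.dist j k ≤ (1 + ε) * truncatedMean N ε (sketchMean (F.input ε δ) ω j k))} ≤
      ENNReal.ofReal (4 * Real.exp (-(N * ε ^ 2 / 589824))) := by
  have hx := F.input_mono ε δ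
  have he : ∀ ω : Tape, sketchMean (F.input ε δ) ω j k = fun r => blockMean ((F.input ε δ).real 1)
      (F.diffCoef ε δ ((F.input ε δ).real 2) j k) (F.diffCoef ε δ ((F.input ε δ).real 3) j k)
      (tapeBlock (s - 1) ω r) := by
    intro ω
    funext r
    refine sketchMean_eq_blockMean (m := m) (n := n) rfl rfl rfl ?_ ?_ j.2 k.2
    · intro i hi
      obtain ⟨j, l, e1, e2⟩ := PiecewiseLinearDensities.exists_flatten_eq
        (fun j l => (F.b j l : ℕ)) (fun j l => (F.c j l : ℕ)) hi
      have : F.b j l ≤ F.c j l := (F.b_lt_c j l).le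
      simpa [PiecewiseLinearDensities.input, e1, e2] using this
    · intro i hi
      obtain ⟨j, l, e1, -⟩ := PiecewiseLinearDensities.exists_flatten_eq
        (fun j l => (F.c j l : ℕ)) (fun j l => (F.c j l : ℕ)) hi
      have := (F.c j l).2
      simp only [PiecewiseLinearDensities.input, e1]
      omega
  simp_rw [he, F.dist_eq_cellNorm ε δ j k]
  rcases (cellNorm_nonneg (p := F.diffCoef ε δ ((F.input ε δ).real 2) j k)
    (q := F.diffCoef ε δ ((F.input ε δ).real 3) j k) hx).eq_or_lt with hd | hd
  · simp_rw [blockMean_eq_zero hx hd.symm, truncatedMean_zero N h0, ← hd]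
    simp
  · exact tapeLaw_truncatedMean_blockMean_le hN h0 h1 hx hd

theorem distance_cost_le {m n s N : ℕ} {ε L : ℝ} (hs : s ≤ 2 * m * n) (hm : 2 ≤ m) (h0 : 0 < ε)
    (h1 : ε ≤ 1) (hL : 1 / 2 ≤ L) (hN : 1 ≤ N) (hN' : (N : ℝ) ≤ 2359296 * L / (ε * ε) + 1) :
    (((N * 40 + 40) + ((N * (1230 * (s - 1) + 4 * (m * (100 * n + 100)) + 420) +
      20) + (m * (m * (N * 600 + 220) + 30) + 20)) : ℕ) : ℝ) ≤
      20000000000 * ((m : ℝ) * (m + n) / ε ^ 2 * L) := by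
  have hnat : (N * 40 + 40) + ((N * (1230 * (s - 1) + 4 * (m * (100 * n + 100)) + 420) +
      20) + (m * (m * (N * 600 + 220) + 30) + 20)) ≤ 5000 * (N * (m * (m + n))) := by
    obtain ⟨k, rfl⟩ : ∃ k, m = k + 2 := ⟨m - 2, by omega⟩
    obtain ⟨l, rfl⟩ : ∃ l, N = l + 1 := ⟨N - 1, by omega⟩
    have hs' : s - 1 ≤ 2 * (k + 2) * n := by omega
    have := Nat.mul_le_mul_left (l + 1) hs'
    nlinarith [Nat.zero_le (l * k), Nat.zero_le (l * k * k), Nat.zero_le (l * k * n),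
      Nat.zero_le (k * n), Nat.zero_le (k * k), Nat.zero_le (l * n)]
  -- This absorbs the `+ 1` of the ceiling into the main term, whence `2359298 = 2359296 + 2`.
  have hq : 1 ≤ 2 * (L / (ε * ε)) := by
    rw [← mul_div_assoc, le_div_iff₀ (by positivity)]
    nlinarith
  have hN2 : (N : ℝ) ≤ 2359298 * (L / (ε * ε)) := by
    rw [mul_div_assoc] at hN'
    linarith
  have hM : (0 : ℝ) ≤ (m : ℝ) * (m + n) := by positivity
  calc _ ≤ ((5000 * (N * (m * (m + n))) : ℕ) : ℝ) := by exact_mod_cast hnat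
    _ = 5000 * (N * ((m : ℝ) * (m + n))) := by push_cast; ring
    _ ≤ 5000 * ((2359298 * (L / (ε * ε))) * ((m : ℝ) * (m + n))) := by gcongr
    _ ≤ 20000000000 * ((L / (ε * ε)) * ((m : ℝ) * (m + n))) := by
      have : 0 ≤ (L / (ε * ε)) * ((m : ℝ) * (m + n)) := by positivity
      nlinarith
    _ = _ := by rw [sq]; ring

/-- One program and one constant serve all inputs.  Every run halts within the stated number of
operations, and the event that the output fails has probability at most `δ`. -/
theorem theorem4p1 :
    ∃ (P : RealRAM.Prog) (K : ℝ),
      ∀ (m n s : ℕ) (F : PiecewiseLinearDensities m n s) (ε δ : ℝ),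
        2 ≤ m → 0 < ε → ε ≤ 1 → 0 < δ → δ < 1 →
          (∀ ω : RealRAM.Tape, ∃ (k : ℕ) (τ : RealRAM.State),
            RealRAM.Run ω P (F.input ε δ) k τ ∧
              (k : ℝ) ≤ K * ((m : ℝ) * ((m : ℝ) + (n : ℝ)) / ε ^ 2 * Real.log ((m : ℝ) / δ))) ∧
          RealRAM.tapeLaw
            {ω : RealRAM.Tape | ¬ ∃ (k : ℕ) (τ : RealRAM.State),
              RealRAM.Run ω P (F.input ε δ) k τ ∧ F.RelativeErrorApprox ε (τ.output m)}
            ≤ ENNReal.ofReal δ := by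
  refine ⟨RealRAM.distanceProg, 20000000000, fun m n s F ε δ hm h0 h1 hδ0 hδ1 => ?_⟩
  have hm' : (2 : ℝ) ≤ m := by exact_mod_cast hm
  have hmδ : (2 : ℝ) ≤ m / δ := by
    rw [le_div_iff₀ hδ0]; nlinarith
  set L := Real.log (m / δ) with hL
  have hL2 : 1 / 2 ≤ L := by
    have := Real.log_two_gt_d9
    have h2 := Real.log_le_log (by norm_num) hmδ
    linarith
  set N := RealRAM.roundCount m ε δ with hNdef
  have hN0 : 0 < N := Nat.ceil_pos.mpr (by positivity)
  have hN1 : 2359296 * L / (ε * ε) ≤ N := Nat.le_ceil _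
  have hN2 : (N : ℝ) ≤ 2359296 * L / (ε * ε) + 1 := (Nat.ceil_lt_add_one (by positivity)).le
  have hbound : ∀ i < m * n, (F.input ε δ).nat 1 i ≤ s - 1 ∧ (F.input ε δ).nat 2 i ≤ s - 1 := by
    intro i hi
    obtain ⟨j, l, e1, e2⟩ := PiecewiseLinearDensities.exists_flatten_eq
      (fun j l => (F.b j l : ℕ)) (fun j l => (F.c j l : ℕ)) hi
    have := (F.b j l).2
    have := (F.c j l).2
    simp only [PiecewiseLinearDensities.input, e1, e2]
    omega
  have hrun := fun ω : RealRAM.Tape => RealRAM.distanceProg_halts (ω := ω) (inp := F.input ε δ)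
    (m := m) (n := n) (C := s - 1) (N := N) h0 rfl (fun i hi => (hbound i hi).1)
    (fun i hi => (hbound i hi).2) rfl rfl rfl rfl
  constructor
  · intro ω
    obtain ⟨k, τ, hr, hk, -⟩ := hrun ω
    refine ⟨k, τ, hr, ?_⟩
    exact (Nat.cast_le.mpr hk).trans (distance_cost_le F.s_le hm h0 h1 hL2 hN0 hN2)
  -- Every run halts with the estimator as output, so a failure means that some pair is estimated
  -- badly.
  · have hsub : {ω : RealRAM.Tape | ¬ ∃ (k : ℕ) (τ : RealRAM.State),
        RealRAM.Run ω RealRAM.distanceProg (F.input ε δ) k τ ∧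
          F.RelativeErrorApprox ε (τ.output m)} ⊆ ⋃ jk ∈ (Finset.univ : Finset (Fin m × Fin m)),
        {ω | ¬ ((1 - ε) * truncatedMean N ε (RealRAM.sketchMean (F.input ε δ) ω jk.1 jk.2) ≤
          F.dist jk.1 jk.2 ∧ F.dist jk.1 jk.2 ≤
          (1 + ε) * truncatedMean N ε (RealRAM.sketchMean (F.input ε δ) ω jk.1 jk.2))} := by
      intro ω hω
      by_contra hcon
      simp only [Finset.mem_univ, Set.iUnion_true, Set.mem_iUnion, not_exists,
        Set.mem_ofPred_eq, not_not] at hcon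
      obtain ⟨k, τ, hr, -, hout⟩ := hrun ω
      refine hω ⟨k, τ, hr, fun i j => ?_⟩
      have := hcon (i, j)
      rw [RealRAM.State.output, hout i i.2 j j.2]
      exact this
    -- Since `2359296 = 4 * 589824`, the exponent is at least `4 * log (m/δ)`.
    have hexp : 4 * Real.exp (-(N * ε ^ 2 / 589824)) ≤ 4 * (δ / m) ^ 4 := by
      have e : (δ / m) ^ 4 = Real.exp (-(4 * L)) := by
        rw [Real.exp_neg, show 4 * L = ((4 : ℕ) : ℝ) * L by norm_num, Real.exp_nat_mul, hL,
          Real.exp_log (by positivity), ← inv_pow, inv_div]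
      rw [e]
      gcongr
      rw [div_le_iff₀ (by positivity)] at hN1
      nlinarith
    calc _ ≤ _ := measure_mono hsub
      _ ≤ ∑ jk : Fin m × Fin m, ENNReal.ofReal (4 * (δ / m) ^ 4) :=
        (measure_biUnion_finset_le _ _).trans (Finset.sum_le_sum fun jk _ =>
          (tapeLaw_not_isApprox_le F h0 h1 hN0 jk.1 jk.2).trans (ENNReal.ofReal_le_ofReal hexp))
      _ = ENNReal.ofReal ((m * m : ℕ) * (4 * (δ / m) ^ 4)) := by
        rw [ENNReal.ofReal_mul (p := ((m * m : ℕ) : ℝ)) (by positivity), ENNReal.ofReal_natCast]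
        simp
      _ ≤ ENNReal.ofReal δ := by
        apply ENNReal.ofReal_le_ofReal
        -- The union over `m²` pairs leaves `4 δ⁴ / m²`, which is at most `δ` because `m ≥ 2`.
        have e : ((m * m : ℕ) : ℝ) * (4 * (δ / m) ^ 4) = 4 * δ ^ 4 / m ^ 2 := by
          push_cast; field_simp
        rw [e, div_le_iff₀ (by positivity)]
        have h3 : δ ^ 4 ≤ δ := pow_le_of_le_one hδ0.le hδ1.le (by norm_num)
        nlinarith [mul_le_mul_of_nonneg_left (show (4 : ℝ) ≤ m ^ 2 by nlinarith) hδ0.le]
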